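/- All manifolds are real, finite-dimensional, smooth, Hausdorff, paracompact and connected. Let $\pi:Y\to X$ be a smooth fibre bundle. For $k\ge 0$ let $J^kY$ be its manifold of $k$-jets of local sections ($J^0Y=Y$), with the coordinates $(x^\lambda,y^i_\Lambda)$, $0\le|\Lambda|\le k$, induced by a bundle coordinate chart $(x^\lambda,y^i)$ of $Y$. Let $J^\infty Y=\varprojlim_k J^kY$, with the projective limit topology and the projections $\pi^\infty_k:J^\infty Y\to J^kY$. Then $Y$ is a strong deformation retract of $J^\infty Y$. More precisely: (a) For each $k\ge 1$ the affine jet bundle $J^kY\to J^{k-1}Y$ has a smooth global section. There are smooth real functions $f_k$, $k\ge 1$, with $$f_k(t)=0 \ \text{ for } 0\le t\le 1-2^{-k},\qquad f_k(t)=1\ \text{ for } 1-2^{-(k+1)}\le t\le 1. \tag{1}$$ (b) For every choice of continuous (in particular, of smooth) global sections $\Gamma_{(k)}:J^{k-1}Y\to J^kY$, $k\ge 1$, there is a topological embedding $\gamma:Y\to J^\infty Y$ which is a global section of $\pi^\infty_0$ and satisfies $\pi^\infty_k\circ\gamma=\Gamma_{(k)}\circ\Gamma_{(k-1)}\circ\cdots\circ\Gamma_{(1)}$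 for all $k\geq 1$. For every choice of continuous functions $f_k:[0,1]\to\mathbb R$, $k\ge1$, with (1), there is a continuous map $H:[0,1]\times J^\infty Y\to J^\infty Y$ such that $$H(0,q)=\gamma(\pi^\infty_0(q)),\qquad H(1,q)=q,\qquad H(t,\gamma(y))=\gamma(y),\qquad \pi^\infty_0(H(t,q))=\pi^\infty_0(q)$$ for all $t\in[0,1]$, $q\in J^\infty Y$, $y\in Y$, and which in each bundle coordinate chart whose domain contains $\pi^\infty_0(q)$ is given by $$y^i_\Lambda(H(t,q))=f_k(t)\,y^i_\Lambda(q)+(1-f_k(t))\,y^i_\Lambda\bigl(\Gamma_{(k)}(\pi^\infty_{k-1}(H(t,q)))\bigr),\qquad |\Lambda|=k\ge 1 .$$ Thus $H$ moves the coordinates of order $k$ between the section values and their original values while $t$ runs through $[1-2^{-k},1-2^{-(k+1)}]$. -/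

import Mathlib

open Set Filter Topology
open scoped Manifold ContDiff unitInterval

noncomputable section

/-- `π : Y → X` is a smooth fibre bundle with typical fibre `F`: it is smooth, and locally over `X`
it is isomorphic, by a diffeomorphism over the base, to a product with `F`. -/
structure IsSmoothFibreBundle (EX EY EF : Type*)
    [NormedAddCommGroup EX] [NormedSpace ℝ EX] [NormedAddCommGroup EY] [NormedSpace ℝ EY]
    [NormedAddCommGroup EF] [NormedSpace ℝ EF]
    {X Y : Type*} (F : Type*) [TopologicalSpace X] [ChartedSpace EX X]
    [TopologicalSpace Y] [ChartedSpace EY Y] [TopologicalSpace F] [ChartedSpace EF F]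
    (π : Y → X) : Prop where
  contMDiff : ContMDiff 𝓘(ℝ, EY) 𝓘(ℝ, EX) ∞ π
  locally_trivial : ∀ x : X, ∃ e : Bundle.Trivialization F π, x ∈ e.baseSet ∧
    ContMDiffOn 𝓘(ℝ, EY) (𝓘(ℝ, EX).prod 𝓘(ℝ, EF)) ∞ e e.source ∧
    ContMDiffOn (𝓘(ℝ, EX).prod 𝓘(ℝ, EF)) 𝓘(ℝ, EY) ∞ e.toOpenPartialHomeomorph.symm e.target

/-- A bundle coordinate chart `(x^λ, y^i)` of `π : Y → X`: a smooth chart `base` of `X` with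
coordinates in `EX`, and a smooth chart `total` of `Y` with coordinates in `EX × EF`,
whose first component is the coordinate of the base point. -/
structure BundleChart (EX EY EF : Type*)
    [NormedAddCommGroup EX] [NormedSpace ℝ EX] [NormedAddCommGroup EY] [NormedSpace ℝ EY]
    [NormedAddCommGroup EF] [NormedSpace ℝ EF]
    {X Y : Type*} [TopologicalSpace X] [ChartedSpace EX X]
    [TopologicalSpace Y] [ChartedSpace EY Y] (π : Y → X) where
  base : OpenPartialHomeomorph X EX
  total : OpenPartialHomeomorph Y (EX × EF)
  base_smooth : ContMDiffOn 𝓘(ℝ, EX) 𝓘(ℝ, EX) ∞ base base.source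
  base_symm_smooth : ContMDiffOn 𝓘(ℝ, EX) 𝓘(ℝ, EX) ∞ base.symm base.target
  total_smooth : ContMDiffOn 𝓘(ℝ, EY) 𝓘(ℝ, EX × EF) ∞ total total.source
  total_symm_smooth : ContMDiffOn 𝓘(ℝ, EX × EF) 𝓘(ℝ, EY) ∞ total.symm total.target
  proj_mem : ∀ y ∈ total.source, π y ∈ base.source
  fst_eq : ∀ y ∈ total.source, (total y).1 = base (π y)

/-- A smooth local section of `π` defined near the point `pt`
(the values of `toFun` away from `pt` are irrelevant). -/
structure LocalSection (EX EY : Type*)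
    [NormedAddCommGroup EX] [NormedSpace ℝ EX] [NormedAddCommGroup EY] [NormedSpace ℝ EY]
    {X Y : Type*} [TopologicalSpace X] [ChartedSpace EX X]
    [TopologicalSpace Y] [ChartedSpace EY Y] (π : Y → X) where
  pt : X
  toFun : X → Y
  smooth : ∀ᶠ x in 𝓝 pt, ContMDiffAt 𝓘(ℝ, EX) 𝓘(ℝ, EY) ∞ toFun x
  isSection : ∀ᶠ x in 𝓝 pt, π (toFun x) = x

/-- The coordinate space of `k`-jets: a point `x ∈ EX` and, for each `m ≤ k`, an `m`-linear map
`EX^m → EF`, whose components in linear coordinates are the `y^i_Λ` with `|Λ| = m`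
(for `m = 0` it is the element `y` of `EF`). -/
abbrev JetCoord (EX EF : Type*) [NormedAddCommGroup EX] [NormedSpace ℝ EX]
    [NormedAddCommGroup EF] [NormedSpace ℝ EF] (k : ℕ) : Type _ :=
  EX × ((m : Fin (k + 1)) → ContinuousMultilinearMap ℝ (fun _ : Fin (m : ℕ) => EX) EF)

section

variable {EX EY EF : Type*}
  [NormedAddCommGroup EX] [NormedSpace ℝ EX] [NormedAddCommGroup EY] [NormedSpace ℝ EY]
  [NormedAddCommGroup EF] [NormedSpace ℝ EF]
  {X Y : Type*} [TopologicalSpace X] [ChartedSpace EX X]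
  [TopologicalSpace Y] [ChartedSpace EY Y] {π : Y → X}

/-- The value of a local section at its base point. -/
def LocalSection.val (s : LocalSection EX EY π) : Y := s.toFun s.pt

/-- The fibre part `y^i(x^λ)` of a local section in a bundle chart, as a function of the
base coordinates. -/
def LocalSection.rep (s : LocalSection EX EY π) (c : BundleChart EX EY EF π) : EX → EF :=
  fun z => (c.total (s.toFun (c.base.symm z))).2

open Classical in
/-- The coordinates of the `k`-jet of `s` at its base point in a bundle chart: the base coordinates
and the derivatives of orders `0, …, k` of the local representative.
Outside of the domain of the chart the value is set to be `0`. -/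
def LocalSection.jetCoord (s : LocalSection EX EY π) (c : BundleChart EX EY EF π) (k : ℕ) :
    JetCoord EX EF k :=
  if s.val ∈ c.total.source then
    (c.base s.pt, fun m => iteratedFDeriv ℝ (m : ℕ) (s.rep c) (c.base s.pt))
  else 0

/-- The coordinate domain that corresponds to a bundle chart: the coordinates of orders `≥ 1`
are unrestricted. -/
def BundleChart.jetTarget (c : BundleChart EX EY EF π) (k : ℕ) : Set (JetCoord EX EF k) :=
  {p | (p.1, p.2 0 (fun _ => 0)) ∈ c.total.target}

end

section

variable (EX EY EF : Type*)
  [NormedAddCommGroup EX] [NormedSpace ℝ EX] [NormedAddCommGroup EY] [NormedSpace ℝ EY]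
  [NormedAddCommGroup EF] [NormedSpace ℝ EF]
  {X Y : Type*} [TopologicalSpace X] [ChartedSpace EX X]
  [TopologicalSpace Y] [ChartedSpace EY Y] (π : Y → X)

/-- Two local sections have the same `k`-jet if they have the same base point, the same value there,
and the same derivatives up to order `k` there in bundle coordinates. -/
def jetSetoid (k : ℕ) : Setoid (LocalSection EX EY π) where
  r s s' := s.pt = s'.pt ∧ s.val = s'.val ∧
    ∀ c : BundleChart EX EY EF π, s.jetCoord c k = s'.jetCoord c k
  iseqv :=
    ⟨fun _ => ⟨rfl, rfl, fun _ => rfl⟩,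
     fun h => ⟨h.1.symm, h.2.1.symm, fun c => (h.2.2 c).symm⟩,
     fun h h' => ⟨h.1.trans h'.1, h.2.1.trans h'.2.1, fun c => (h.2.2 c).trans (h'.2.2 c)⟩⟩

/-- The jet space `J^k Y` of `k`-jets of local sections of `π : Y → X`. -/
def Jet (k : ℕ) : Type _ := Quotient (jetSetoid EX EY EF π k)

end

section

variable {EX EY EF : Type*}
  [NormedAddCommGroup EX] [NormedSpace ℝ EX] [NormedAddCommGroup EY] [NormedSpace ℝ EY]
  [NormedAddCommGroup EF] [NormedSpace ℝ EF]
  {X Y : Type*} [TopologicalSpace X] [ChartedSpace EX X]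
  [TopologicalSpace Y] [ChartedSpace EY Y] {π : Y → X}

/-- The projection `π^k_0 : J^k Y → Y`. -/
def Jet.eval {k : ℕ} : Jet EX EY EF π k → Y :=
  Quotient.lift (fun s : LocalSection EX EY π => s.val) (fun _ _ h => h.2.1)

/-- The jet coordinates `(x^λ, y^i_Λ)`, `0 ≤ |Λ| ≤ k`, on `J^k Y` that a bundle chart induces;
meaningful for jets whose value in `Y` is in the domain of the chart. -/
def Jet.coord {k : ℕ} (c : BundleChart EX EY EF π) : Jet EX EY EF π k → JetCoord EX EF k :=
  Quotient.lift (fun s : LocalSection EX EY π => s.jetCoord c k) (fun _ _ h => h.2.2 c)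

/-- The jet coordinates `y^i_Λ` of top order `|Λ| = k` on `J^k Y`. -/
def Jet.topCoord {k : ℕ} (c : BundleChart EX EY EF π) (j : Jet EX EY EF π k) :
    ContinuousMultilinearMap ℝ (fun _ : Fin k => EX) EF :=
  (j.coord c).2 (Fin.last k)

theorem LocalSection.jetCoord_of_succ {s s' : LocalSection EX EY π}
    {c : BundleChart EX EY EF π} {k : ℕ} (hv : s.val = s'.val)
    (h : s.jetCoord c (k + 1) = s'.jetCoord c (k + 1)) : s.jetCoord c k = s'.jetCoord c k := by
  unfold LocalSection.jetCoord at h ⊢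
  rw [← hv] at h ⊢
  by_cases hs : s.val ∈ c.total.source
  · simp only [if_pos hs] at h ⊢
    obtain ⟨h1, h2⟩ := Prod.mk.inj h
    exact Prod.ext h1 (funext fun m => congrFun h2 m.castSucc)
  · simp only [if_neg hs]

/-- The projection `π^{k+1}_k : J^{k+1} Y → J^k Y`. -/
def Jet.proj {k : ℕ} : Jet EX EY EF π (k + 1) → Jet EX EY EF π k :=
  Quotient.map' id
    (fun _ _ h => ⟨h.1, h.2.1, fun c => LocalSection.jetCoord_of_succ h.2.1 (h.2.2 c)⟩)

/-- The manifold topology of `J^k Y`, generated by the coordinate-open subsets of the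
coordinate domains of the bundle charts. -/
instance Jet.instTopologicalSpace {k : ℕ} : TopologicalSpace (Jet EX EY EF π k) :=
  TopologicalSpace.generateFrom
    {U | ∃ (c : BundleChart EX EY EF π) (W : Set (JetCoord EX EF k)), IsOpen W ∧
      U = {j | j.eval ∈ c.total.source ∧ j.coord c ∈ W}}

/-- `Γ` is a continuous global section of `J^{k+1} Y → J^k Y`. -/
structure IsContinuousJetSection {k : ℕ} (Γ : Jet EX EY EF π k → Jet EX EY EF π (k + 1)) :
    Prop where
  proj_apply : ∀ j, (Γ j).proj = j
  continuous : Continuous Γ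

/-- `Γ` is a smooth global section of `J^{k+1} Y → J^k Y`: in the jet coordinates of each bundle
chart it is given by a smooth map. (The values of the coordinates are symmetric multilinear maps;
a map on an open set of these is smooth if and only if it is the restriction of a smooth map.) -/
structure IsSmoothJetSection {k : ℕ} (Γ : Jet EX EY EF π k → Jet EX EY EF π (k + 1)) : Prop
    extends IsContinuousJetSection Γ where
  smooth_coord : ∀ c : BundleChart EX EY EF π,
    ∃ G : JetCoord EX EF k → JetCoord EX EF (k + 1), ContDiffOn ℝ ∞ G (c.jetTarget k) ∧
      ∀ j : Jet EX EY EF π k, j.eval ∈ c.total.source → (Γ j).coord c = G (j.coord c)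

end

section

variable (EX EY EF : Type*)
  [NormedAddCommGroup EX] [NormedSpace ℝ EX] [NormedAddCommGroup EY] [NormedSpace ℝ EY]
  [NormedAddCommGroup EF] [NormedSpace ℝ EF]
  {X Y : Type*} [TopologicalSpace X] [ChartedSpace EX X]
  [TopologicalSpace Y] [ChartedSpace EY Y] (π : Y → X)

/-- The infinite-order jet space `J^∞ Y`, the projective limit of the spaces `J^k Y` with the
projective limit topology. -/
abbrev JetInf : Type _ :=
  {q : (k : ℕ) → Jet EX EY EF π k // ∀ k, (q (k + 1)).proj = q k}

variable {EX EY EF π}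

/-- The projection `π^∞_0 : J^∞ Y → Y`. -/
def JetInf.eval (q : JetInf EX EY EF π) : Y := (q.1 0).eval

end

/-- The inclusion `i : A → Z`, the retraction `r : Z → A` and the homotopy `H` exhibit `A` as a
strong deformation retract of `Z`: `i` is an embedding, `r ∘ i = id`, and `H` is a homotopy
from `i ∘ r` to the identity of `Z` that is stationary on the image of `A`. -/
structure IsStrongDeformationRetract {A Z : Type*} [TopologicalSpace A] [TopologicalSpace Z]
    (i : A → Z) (r : Z → A) (H : I × Z → Z) : Prop where
  isEmbedding : IsEmbedding i
  continuous_retraction : Continuous r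
  retraction_apply : ∀ a, r (i a) = a
  continuous_homotopy : Continuous H
  homotopy_zero : ∀ z, H (0, z) = i (r z)
  homotopy_one : ∀ z, H (1, z) = z
  homotopy_fixed : ∀ t a, H (t, i a) = i a

/-- Continuous functions `f_k`, `k ≥ 1`, on `[0,1]` such that `f_k = 0` on `[0, 1 - 2^{-k}]` and
`f_k = 1` on `[1 - 2^{-(k+1)}, 1]`. -/
structure IsStepFamily (f : ℕ → ℝ → ℝ) : Prop where
  continuousOn : ∀ k, 1 ≤ k → ContinuousOn (f k) (Icc 0 1)
  eq_zero : ∀ k, 1 ≤ k → ∀ t ∈ Icc (0 : ℝ) 1, t ≤ 1 - (1 / 2) ^ k → f k t = 0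
  eq_one : ∀ k, 1 ≤ k → ∀ t ∈ Icc (0 : ℝ) 1, 1 - (1 / 2) ^ (k + 1) ≤ t → f k t = 1

end

/-!
By the Faà di Bruno formula, a change of bundle charts changes the coordinates of a `(k + 1)`-jet by
a smooth map that is affine in the coordinates of order `k + 1`. Hence jets over the same `k`-jet
have affine combinations, and a partition of unity glues the sections of `J^{k+1} Y → J^k Y` whose
coordinates of order `k + 1` vanish in a chart. The homotopy is built order by order: its jet of
order `k + 1` is an affine combination, with weights `f_{k+1}(t)` and `1 - f_{k+1}(t)`, of the
original jet and the value of the section. If `f_{k+1}(t) ≠ 0` then `f_m(t) = 1` for all `m ≤ k`, so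
the orders up to `k` have not been moved and the two jets do lie over the same `k`-jet.
-/

section TaylorComposition

variable {𝕜 E F G Z ι : Type*} [NontriviallyNormedField 𝕜] [NormedAddCommGroup E] [NormedSpace 𝕜 E]
  [NormedAddCommGroup F] [NormedSpace 𝕜 F] [NormedAddCommGroup G] [NormedSpace 𝕜 G]
  [NormedAddCommGroup Z] [NormedSpace 𝕜 Z]

theorem taylorComp_congr {q q' : FormalMultilinearSeries 𝕜 F G}
    {p p' : FormalMultilinearSeries 𝕜 E F} {n : ℕ}
    (hq : ∀ m ≤ n, q m = q' m) (hp : ∀ m ≤ n, p m = p' m) :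
    q.taylorComp p n = q'.taylorComp p' n := by
  refine Finset.sum_congr rfl fun c _ => ?_
  unfold FormalMultilinearSeries.compAlongOrderedFinpartition
  rw [hq _ c.length_le]
  congr 1
  exact funext fun i => hp _ (c.partSize_le i)

theorem taylorComp_zero_apply (q : FormalMultilinearSeries 𝕜 F G)
    (p : FormalMultilinearSeries 𝕜 E F) (v : Fin 0 → E) (w : Fin 0 → F) :
    q.taylorComp p 0 v = q 0 w := by
  unfold FormalMultilinearSeries.taylorComp
  rw [Fintype.sum_unique]
  exact congrArg (q 0) (Subsingleton.elim _ w)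

theorem taylorComp_sum_left (S : Finset ι) (a : ι → 𝕜)
    {Q : FormalMultilinearSeries 𝕜 F G} {q : ι → FormalMultilinearSeries 𝕜 F G}
    (p : FormalMultilinearSeries 𝕜 E F) {n : ℕ}
    (hQ : ∀ m ≤ n, Q m = ∑ i ∈ S, a i • q i m) :
    Q.taylorComp p n = ∑ i ∈ S, a i • (q i).taylorComp p n := by
  simp only [FormalMultilinearSeries.taylorComp, Finset.smul_sum]
  rw [Finset.sum_comm]
  refine Finset.sum_congr rfl fun c _ => ?_
  ext v
  simp [hQ _ c.length_le]

theorem partSize_add_partSize_le {n : ℕ} (c : OrderedFinpartition n) {i j : Fin c.length}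
    (hij : i ≠ j) : c.partSize i + c.partSize j ≤ n := by
  have hsum : ∑ m, c.partSize m = n := by simpa using c.sum_sigma_eq_sum fun _ => (1 : ℕ)
  calc c.partSize i + c.partSize j = ∑ m ∈ {i, j}, c.partSize m := (Finset.sum_pair hij).symm
    _ ≤ ∑ m, c.partSize m := Finset.sum_le_sum_of_subset (Finset.subset_univ _)
    _ = n := hsum

theorem map_update_sum_smul {R κ N : Type*} [CommSemiring R] [DecidableEq κ] {M : κ → Type*}
    [∀ i, AddCommMonoid (M i)] [∀ i, Module R (M i)] [AddCommMonoid N] [Module R N]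
    (B : MultilinearMap R M N) (S : Finset ι) (a : ι → R) (x : ∀ i, M i) (i : κ)
    (y : ι → M i) :
    B (Function.update x i (∑ l ∈ S, a l • y l)) =
      ∑ l ∈ S, a l • B (Function.update x i (y l)) := by
  simpa only [B.map_update_smul] using B.map_update_sum S i (fun l => a l • y l) x

/-- A part of size `n` is the only part of an ordered partition of `Fin n`, so every summand of
the Faà di Bruno formula is either linear in or independent of the top coefficient of `P`. -/
theorem taylorComp_sum_right (S : Finset ι) (a : ι → 𝕜) (ha : ∑ i ∈ S, a i = 1)
    (q : FormalMultilinearSeries 𝕜 F G)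
    {P : FormalMultilinearSeries 𝕜 E F} {p : ι → FormalMultilinearSeries 𝕜 E F} {n : ℕ}
    (hlow : ∀ m < n, ∀ i ∈ S, p i m = P m) (htop : P n = ∑ i ∈ S, a i • p i n) :
    q.taylorComp P n = ∑ i ∈ S, a i • q.taylorComp (p i) n := by
  simp only [FormalMultilinearSeries.taylorComp, Finset.smul_sum]
  rw [Finset.sum_comm]
  refine Finset.sum_congr rfl fun c _ => ?_
  unfold FormalMultilinearSeries.compAlongOrderedFinpartition
  simp only [← OrderedFinpartition.compAlongOrderedFinpartitionL_apply]
  set B := c.compAlongOrderedFinpartitionL 𝕜 E F G (q c.length)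
  by_cases h : ∃ i, c.partSize i = n
  · obtain ⟨i, hi⟩ := h
    have hsmall : ∀ j ≠ i, c.partSize j < n := fun j hj => by
      have := partSize_add_partSize_le c hj
      have := c.partSize_pos i
      omega
    have hupdate : ∀ l ∈ S, (fun m => p l (c.partSize m)) =
        Function.update (fun m => P (c.partSize m)) i (p l (c.partSize i)) := fun l hl =>
      Function.eq_update_iff.2 ⟨rfl, fun m hm => hlow _ (hsmall m hm) l hl⟩
    have hsum : P (c.partSize i) = ∑ l ∈ S, a l • p l (c.partSize i) := by rw [hi, htop]
    rw [← Function.update_eq_self i fun m => P (c.partSize m), hsum]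
    refine (map_update_sum_smul B.toMultilinearMap S a _ i _).trans ?_
    exact Finset.sum_congr rfl fun l hl => by
      rw [hupdate l hl, ContinuousMultilinearMap.coe_coe]
  · have hconst : ∀ l ∈ S, (fun m => p l (c.partSize m)) = fun m => P (c.partSize m) :=
      fun l hl => funext fun m =>
        hlow _ ((c.partSize_le m).lt_of_ne fun hm => h ⟨m, hm⟩) l hl
    rw [Finset.sum_congr rfl fun l hl => by rw [hconst l hl], ← Finset.sum_smul, ha, one_smul]

theorem contDiffAt_taylorComp {r : WithTop ℕ∞}
    {q : Z → FormalMultilinearSeries 𝕜 F G} {p : Z → FormalMultilinearSeries 𝕜 E F} {n : ℕ} {z : Z}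
    (hq : ∀ m ≤ n, ContDiffAt 𝕜 r (fun w => q w m) z)
    (hp : ∀ m ≤ n, ContDiffAt 𝕜 r (fun w => p w m) z) :
    ContDiffAt 𝕜 r (fun w => (q w).taylorComp (p w) n) z := by
  refine ContDiffAt.sum fun c _ => ?_
  have hB := ((c.compAlongOrderedFinpartitionL 𝕜 E F G).analyticOnNhd_uncurry_of_multilinear
    (s := univ)).contDiffOn (n := r) uniqueDiffOn_univ
  have hparts : ContDiffAt 𝕜 r (fun w i => p w (c.partSize i)) z :=
    contDiffAt_pi.2 fun i => hp _ (c.partSize_le i)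
  exact ((contDiffOn_univ.1 hB).contDiffAt (x := (q z c.length, fun i => p z (c.partSize i)))).comp
    z ((hq _ c.length_le).prodMk hparts)

end TaylorComposition

section PrescribedDerivatives

variable {𝕜 E F : Type*} [NontriviallyNormedField 𝕜] [NormedAddCommGroup E] [NormedSpace 𝕜 E]
  [NormedAddCommGroup F] [NormedSpace 𝕜 F]

theorem iteratedFDeriv_comp_smul_right (l : 𝕜) (u : E → F) (n : ℕ) :
    iteratedFDeriv 𝕜 n (fun z => u (l • z)) 0 = l ^ n • iteratedFDeriv 𝕜 n u 0 := by
  rcases eq_or_ne l 0 with rfl | hl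
  · rcases n with - | n
    · ext; simp
    · simp [iteratedFDeriv_const_of_ne]
  let e : E ≃L[𝕜] E := ContinuousLinearEquiv.smulLeft (Units.mk0 l hl)
  have hcomp := e.iteratedFDerivWithin_comp_right (𝕜 := 𝕜) u uniqueDiffOn_univ
    (x := 0) (mem_univ _) n
  simp only [preimage_univ, iteratedFDerivWithin_univ] at hcomp
  ext v
  simpa [e, Units.smul_def, Function.comp_def, ContinuousMultilinearMap.map_smul_univ]
    using congrArg (· v) hcomp

theorem iteratedFDeriv_comp_homothety (l : 𝕜) (u : E → F) (x : E) (n : ℕ) :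
    iteratedFDeriv 𝕜 n (fun z => u (x + l • (z - x))) x = l ^ n • iteratedFDeriv 𝕜 n u x := by
  rw [iteratedFDeriv_comp_sub (f := fun w => u (x + l • w)), sub_self,
    iteratedFDeriv_comp_smul_right l fun w => u (x + w), iteratedFDeriv_comp_add_left, add_zero]

theorem eventually_contDiffAt_comp_homothety {u : E → F} {x : E}
    (hu : ∀ᶠ z in 𝓝 x, ContDiffAt 𝕜 ∞ u z) (l : 𝕜) :
    ∀ᶠ z in 𝓝 x, ContDiffAt 𝕜 ∞ (fun z => u (x + l • (z - x))) z := by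
  have hcont : Continuous fun z => x + l • (z - x) := by fun_prop
  have hlim : Tendsto (fun z => x + l • (z - x)) (𝓝 x) (𝓝 x) := by simpa using hcont.tendsto x
  filter_upwards [hlim.eventually hu] with z hz
  exact hz.comp z (by fun_prop)

theorem exists_polynomial_eval_two_pow (K : Type*) [Field K] [CharZero K] (n : ℕ) :
    ∃ p : Polynomial K, p.eval (2 ^ n) = 0 ∧ ∀ m < n, p.eval (2 ^ m) = 1 := by
  have hinj : InjOn (fun m : ℕ => (2 : K) ^ m) (Finset.range (n + 1)) :=
    fun i _ j _ (hij : (2 : K) ^ i = 2 ^ j) =>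
      Nat.pow_right_injective le_rfl (mod_cast hij : 2 ^ i = 2 ^ j)
  have heval := fun m (hm : m ∈ Finset.range (n + 1)) =>
    Lagrange.eval_interpolate_at_node (fun m => if m = n then (0 : K) else 1) hinj hm
  refine ⟨_, (heval n (by simp)).trans (if_pos rfl), fun m hm => ?_⟩
  exact (heval m (Finset.mem_range.2 (by omega))).trans (if_neg hm.ne)

/-- The homothety with centre `x` and ratio `l` multiplies the derivative of order `m` at `x` by
`l ^ m`, so a polynomial in the homothety of ratio `2` rescales each order separately. -/
theorem exists_iteratedFDeriv_eq_zero [CharZero 𝕜] {u : E → F} {x : E}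
    (hu : ∀ᶠ z in 𝓝 x, ContDiffAt 𝕜 ∞ u z) (n : ℕ) :
    ∃ v : E → F, (∀ᶠ z in 𝓝 x, ContDiffAt 𝕜 ∞ v z) ∧ iteratedFDeriv 𝕜 n v x = 0 ∧
      ∀ m < n, iteratedFDeriv 𝕜 m v x = iteratedFDeriv 𝕜 m u x := by
  obtain ⟨p, hpn, hpm⟩ := exists_polynomial_eval_two_pow 𝕜 n
  let w : ℕ → E → F := fun i z => u (x + (2 : 𝕜) ^ i • (z - x))
  have hw : ∀ i, ∀ᶠ z in 𝓝 x, ContDiffAt 𝕜 ∞ (w i) z := fun i =>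
    eventually_contDiffAt_comp_homothety hu _
  have hderiv : ∀ m, iteratedFDeriv 𝕜 m (fun z => ∑ i ∈ p.support, p.coeff i • w i z) x =
      p.eval (2 ^ m) • iteratedFDeriv 𝕜 m u x := by
    intro m
    have hwm : ∀ i, ContDiffAt 𝕜 m (w i) x := fun i =>
      (hw i).self_of_nhds.of_le (mod_cast le_top)
    rw [iteratedFDeriv_fun_sum_apply fun i _ => (hwm i).const_smul _, Polynomial.eval_eq_sum,
      Polynomial.sum, Finset.sum_smul]
    refine Finset.sum_congr rfl fun i _ => ?_
    rw [iteratedFDeriv_const_smul_apply' (hwm i), iteratedFDeriv_comp_homothety, smul_smul,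
      ← pow_mul, ← pow_mul, mul_comm i m]
  refine ⟨_, ?_, by rw [hderiv, hpn, zero_smul], fun m hm => by rw [hderiv, hpm m hm, one_smul]⟩
  filter_upwards [(p.support.eventually_all).2 fun i _ => hw i] with z hz
  exact ContDiffAt.sum fun i hi => (hz i hi).const_smul _

end PrescribedDerivatives

section SigmaCompact

variable {M : Type*} [TopologicalSpace M]

theorem exists_locallyFinite_isOpen_cover_isCompact_closure [T2Space M] [LocallyCompactSpace M]
    [ParacompactSpace M] :
    ∃ V : M → Set M, (∀ i, IsOpen (V i)) ∧ ⋃ i, V i = univ ∧ LocallyFinite V ∧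
      ∀ i, IsCompact (closure (V i)) := by
  choose K hK hKx using fun x : M => exists_compact_mem_nhds x
  obtain ⟨V, hopen, hcover, hfinite, hsub⟩ := precise_refinement (fun x => interior (K x))
    (fun _ => isOpen_interior)
    (eq_univ_of_forall fun x => mem_iUnion.2 ⟨x, mem_interior_iff_mem_nhds.2 (hKx x)⟩)
  refine ⟨V, hopen, hcover, hfinite, fun x => (hK x).of_isClosed_subset isClosed_closure ?_⟩
  exact closure_minimal ((hsub x).trans interior_subset) (hK x).isClosed

theorem isClopen_of_forall_inter_nonempty_subset {ι : Type*} {V : ι → Set M}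
    (hopen : ∀ i, IsOpen (V i)) (hcover : ⋃ i, V i = univ) {C : Set M}
    (hC : ∀ i, (V i ∩ C).Nonempty → V i ⊆ C) : IsClopen C := by
  have hmem : ∀ y, ∃ i, y ∈ V i := fun y => mem_iUnion.1 (hcover ▸ mem_univ y)
  refine ⟨isClosed_of_closure_subset fun y hy => ?_, isOpen_iff_mem_nhds.2 fun y hy => ?_⟩
  · obtain ⟨i, hi⟩ := hmem y
    exact hC i (mem_closure_iff_nhds.1 hy (V i) ((hopen i).mem_nhds hi)) hi
  · obtain ⟨i, hi⟩ := hmem y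
    exact mem_of_superset ((hopen i).mem_nhds hi) (hC i ⟨y, hi, hy⟩)

/-- Starting from a point and repeatedly adjoining the finitely many closed cover members that
meet the set obtained so far exhausts a clopen set by compact sets. -/
theorem sigmaCompactSpace_of_connectedSpace [T2Space M] [LocallyCompactSpace M]
    [ParacompactSpace M] [ConnectedSpace M] : SigmaCompactSpace M := by
  obtain ⟨V, hopen, hcover, hfinite, hcompact⟩ :=
    exists_locallyFinite_isOpen_cover_isCompact_closure (M := M)
  let next : Set M → Set M := fun C => ⋃ i ∈ {i | (V i ∩ C).Nonempty}, closure (V i)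
  let x₀ : M := Classical.arbitrary M
  let L : ℕ → Set M := fun n => next^[n] {x₀}
  have hsucc : ∀ n, L (n + 1) = next (L n) := fun n => Function.iterate_succ_apply' next n {x₀}
  have hL : ∀ n, IsCompact (L n) := by
    intro n
    induction n with
    | zero => exact isCompact_singleton
    | succ n ih =>
      rw [hsucc]
      exact (hfinite.finite_nonempty_inter_compact ih).isCompact_biUnion fun i _ => hcompact i
  have hclopen : IsClopen (⋃ n, L n) := by
    refine isClopen_of_forall_inter_nonempty_subset hopen hcover fun i hi y hy => ?_
    obtain ⟨z, hzi, hz⟩ := hi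
    obtain ⟨n, hn⟩ := mem_iUnion.1 hz
    refine mem_iUnion.2 ⟨n + 1, ?_⟩
    rw [hsucc]
    exact mem_biUnion (show i ∈ {i | (V i ∩ L n).Nonempty} from ⟨z, hzi, hn⟩) (subset_closure hy)
  exact ⟨⟨L, hL, hclopen.eq_univ ⟨x₀, mem_iUnion.2 ⟨0, rfl⟩⟩⟩⟩

end SigmaCompact

/-- `π : Y → X` is a fibred manifold: bundle charts exist around every point of `Y`. In contrast to
the usual definition, `π` need not be surjective. -/
def IsFibredManifold (EX EY EF : Type*)
    [NormedAddCommGroup EX] [NormedSpace ℝ EX] [NormedAddCommGroup EY] [NormedSpace ℝ EY]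
    [NormedAddCommGroup EF] [NormedSpace ℝ EF]
    {X Y : Type*} [TopologicalSpace X] [ChartedSpace EX X]
    [TopologicalSpace Y] [ChartedSpace EY Y] (π : Y → X) : Prop :=
  ∀ y, ∃ c : BundleChart EX EY EF π, y ∈ c.total.source

noncomputable section

variable {EX EY EF : Type*}
  [NormedAddCommGroup EX] [NormedSpace ℝ EX] [NormedAddCommGroup EY] [NormedSpace ℝ EY]
  [NormedAddCommGroup EF] [NormedSpace ℝ EF]
  {X Y : Type*} [TopologicalSpace X] [ChartedSpace EX X]
  [TopologicalSpace Y] [ChartedSpace EY Y] {π : Y → X}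

namespace BundleChart

/-- The bundle chart obtained from a smooth local trivialization and charts of the base and of the
typical fibre. -/
def ofTrivialization [IsManifold 𝓘(ℝ, EX) ∞ X] {F : Type*} [TopologicalSpace F]
    [ChartedSpace EF F] [IsManifold 𝓘(ℝ, EF) ∞ F] (e : Bundle.Trivialization F π)
    (he : ContMDiffOn 𝓘(ℝ, EY) (𝓘(ℝ, EX).prod 𝓘(ℝ, EF)) ∞ e e.source)
    (he' : ContMDiffOn (𝓘(ℝ, EX).prod 𝓘(ℝ, EF)) 𝓘(ℝ, EY) ∞ e.toOpenPartialHomeomorph.symm e.target)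
    (x : X) (v : F) : BundleChart EX EY EF π where
  base := chartAt EX x
  total := e.toOpenPartialHomeomorph.trans ((chartAt EX x).prod (chartAt EF v))
  base_smooth := contMDiffOn_chart
  base_symm_smooth := contMDiffOn_chart_symm
  total_smooth := by
    have hchart : ContMDiffOn (𝓘(ℝ, EX).prod 𝓘(ℝ, EF)) 𝓘(ℝ, EX × EF) ∞
        ((chartAt EX x).prod (chartAt EF v)) ((chartAt EX x).prod (chartAt EF v)).source :=
      (contMDiffOn_chart.comp contMDiffOn_fst fun q hq => hq.1).prodMk_space
        (contMDiffOn_chart.comp contMDiffOn_snd fun q hq => hq.2)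
    rw [OpenPartialHomeomorph.trans_source]
    exact hchart.comp (he.mono inter_subset_left) fun y hy => hy.2
  total_symm_smooth := by
    have hbase : ContMDiffOn 𝓘(ℝ, EX) 𝓘(ℝ, EX) ∞ (chartAt EX x).symm (chartAt EX x).target :=
      contMDiffOn_chart_symm
    have hfibre : ContMDiffOn 𝓘(ℝ, EF) 𝓘(ℝ, EF) ∞ (chartAt EF v).symm (chartAt EF v).target :=
      contMDiffOn_chart_symm
    have hchart : ContMDiffOn 𝓘(ℝ, EX × EF) (𝓘(ℝ, EX).prod 𝓘(ℝ, EF)) ∞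
        ((chartAt EX x).prod (chartAt EF v)).symm ((chartAt EX x).prod (chartAt EF v)).target :=
      (hbase.comp contDiff_fst.contMDiff.contMDiffOn fun q hq => hq.1).prodMk
        (hfibre.comp contDiff_snd.contMDiff.contMDiffOn fun q hq => hq.2)
    rw [OpenPartialHomeomorph.trans_target]
    exact he'.comp (hchart.mono inter_subset_left) fun q hq => hq.2
  proj_mem y hy := e.coe_fst hy.1 ▸ hy.2.1
  fst_eq y hy := congrArg (chartAt EX x) (e.coe_fst hy.1)

end BundleChart

theorem IsSmoothFibreBundle.isFibredManifold [IsManifold 𝓘(ℝ, EX) ∞ X] {F : Type*}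
    [TopologicalSpace F] [ChartedSpace EF F] [IsManifold 𝓘(ℝ, EF) ∞ F]
    (hπ : IsSmoothFibreBundle EX EY EF F π) : IsFibredManifold EX EY EF π := fun y => by
  obtain ⟨e, hy, he, he'⟩ := hπ.locally_trivial (π y)
  have hye : y ∈ e.source := e.mem_source.2 hy
  refine ⟨.ofTrivialization e he he' (π y) (e y).2, hye, ?_, mem_chart_source EF _⟩
  exact (e.coe_fst hye).symm ▸ mem_chart_source EX (π y)

namespace BundleChart

variable {c c' : BundleChart EX EY EF π}

theorem base_symm_fst {q : EX × EF} (hq : q ∈ c.total.target) :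
    c.base.symm q.1 = π (c.total.symm q) := by
  have hy := c.total.map_target hq
  rw [← c.base.left_inv (c.proj_mem _ hy), ← c.fst_eq _ hy, c.total.right_inv hq]

theorem fst_mem_base_target {q : EX × EF} (hq : q ∈ c.total.target) : q.1 ∈ c.base.target := by
  have hy := c.total.map_target hq
  rw [← c.total.right_inv hq, c.fst_eq _ hy]
  exact c.base.map_source (c.proj_mem _ hy)

variable (c c') in
/-- The change of base coordinates from the chart `c'` to the chart `c`. -/
def baseChange : EX → EX := fun z => c.base (c'.base.symm z)

variable (c c') in
/-- The fibre coordinates of the chart `c'` as functions of the coordinates of the chart `c`. -/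
def fibreChange : EX × EF → EF := fun q => (c'.total (c.total.symm q)).2

variable (c c') in
/-- The overlap of the domains of two charts, in the coordinates of the first one. -/
def overlap : Set (EX × EF) := c.total.target ∩ c.total.symm ⁻¹' c'.total.source

theorem total_mem_overlap {y : Y} (hy : y ∈ c.total.source) (hy' : y ∈ c'.total.source) :
    c.total y ∈ c.overlap c' := by
  refine ⟨c.total.map_source hy, ?_⟩
  rwa [mem_preimage, c.total.left_inv hy]

theorem base_symm_fst_mem_of_mem_overlap {q : EX × EF} (hq : q ∈ c.overlap c') :
    c.base.symm q.1 ∈ c'.base.source :=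
  base_symm_fst hq.1 ▸ c'.proj_mem _ hq.2

theorem contDiffAt_baseChange {z : EX} (hz : z ∈ c'.base.target)
    (hz' : c'.base.symm z ∈ c.base.source) : ContDiffAt ℝ ∞ (c.baseChange c') z := by
  rw [← contMDiffAt_iff_contDiffAt]
  exact (c.base_smooth.contMDiffAt (c.base.open_source.mem_nhds hz')).comp z
    (c'.base_symm_smooth.contMDiffAt (c'.base.open_target.mem_nhds hz))

theorem contDiffAt_fibreChange {q : EX × EF} (hq : q ∈ c.overlap c') :
    ContDiffAt ℝ ∞ (c.fibreChange c') q := by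
  have h : ContDiffAt ℝ ∞ (fun q => c'.total (c.total.symm q)) q := by
    rw [← contMDiffAt_iff_contDiffAt]
    exact (c'.total_smooth.contMDiffAt (c'.total.open_source.mem_nhds hq.2)).comp q
      (c.total_symm_smooth.contMDiffAt (c.total.open_target.mem_nhds hq.1))
  exact h.snd

end BundleChart

namespace LocalSection

variable {s : LocalSection EX EY π} {c c' : BundleChart EX EY EF π}

theorem proj_val : π s.val = s.pt := s.isSection.self_of_nhds

theorem pt_mem (hs : s.val ∈ c.total.source) : s.pt ∈ c.base.source :=
  s.proj_val ▸ c.proj_mem _ hs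

theorem eventually_mem_source (hs : s.val ∈ c.total.source) :
    ∀ᶠ x in 𝓝 s.pt, s.toFun x ∈ c.total.source :=
  s.smooth.self_of_nhds.continuousAt.eventually (c.total.open_source.mem_nhds hs)

theorem tendsto_base_symm (hs : s.val ∈ c.total.source) :
    Tendsto c.base.symm (𝓝 (c.base s.pt)) (𝓝 s.pt) := by
  have := c.base.continuousAt_symm (c.base.map_source (pt_mem hs))
  rwa [ContinuousAt, c.base.left_inv (pt_mem hs)] at this

theorem total_val (hs : s.val ∈ c.total.source) :
    c.total s.val = (c.base s.pt, s.rep c (c.base s.pt)) := by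
  refine Prod.ext ?_ ?_
  · rw [c.fst_eq _ hs, s.proj_val]
  · simp only [rep, c.base.left_inv (pt_mem hs), val]

theorem eventually_contDiffAt_rep (hs : s.val ∈ c.total.source) :
    ∀ᶠ z in 𝓝 (c.base s.pt), ContDiffAt ℝ ∞ (s.rep c) z := by
  have hlim := tendsto_base_symm hs
  filter_upwards [hlim.eventually (eventually_mem_source hs), hlim.eventually s.smooth,
    c.base.open_target.mem_nhds (c.base.map_source (pt_mem hs))] with z hmem hsmooth hz
  have h : ContDiffAt ℝ ∞ (fun z => c.total (s.toFun (c.base.symm z))) z := by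
    rw [← contMDiffAt_iff_contDiffAt]
    exact (c.total_smooth.contMDiffAt (c.total.open_source.mem_nhds hmem)).comp z
      (hsmooth.comp z (c.base_symm_smooth.contMDiffAt (c.base.open_target.mem_nhds hz)))
  exact h.snd

theorem rep_eventuallyEq (hs : s.val ∈ c.total.source) (hs' : s.val ∈ c'.total.source) :
    s.rep c' =ᶠ[𝓝 (c'.base s.pt)]
      (fun z => c.fibreChange c' (z, s.rep c z)) ∘ c.baseChange c' := by
  have hlim := tendsto_base_symm hs'
  filter_upwards [hlim.eventually (c.base.open_source.mem_nhds (pt_mem hs)),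
    hlim.eventually (eventually_mem_source hs), hlim.eventually s.isSection] with z hx hmem hsec
  have htotal : (c.base (c'.base.symm z), (c.total (s.toFun (c'.base.symm z))).2) =
      c.total (s.toFun (c'.base.symm z)) := Prod.ext (by rw [c.fst_eq _ hmem, hsec]) rfl
  simp only [Function.comp_apply, BundleChart.fibreChange, BundleChart.baseChange, rep,
    c.base.left_inv hx]
  rw [htotal, c.total.left_inv hmem]

end LocalSection

namespace JetCoord

variable {k : ℕ}

/-- The coordinates in `EX × EF` of the point of `Y` that underlies a jet. -/
def point (p : JetCoord EX EF k) : EX × EF := (p.1, p.2 0 fun _ => 0)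

/-- The coordinates of order `k` of a `k`-jet. -/
def top (p : JetCoord EX EF k) : ContinuousMultilinearMap ℝ (fun _ : Fin k => EX) EF :=
  p.2 (Fin.last k)

/-- The coordinates of the underlying `k`-jet of a `(k + 1)`-jet. -/
def init (p : JetCoord EX EF (k + 1)) : JetCoord EX EF k := (p.1, fun m => p.2 m.castSucc)

/-- The coordinates of the `(k + 1)`-jet over `p` with top order coordinates `T`. -/
def snoc (p : JetCoord EX EF k) (T : ContinuousMultilinearMap ℝ (fun _ : Fin (k + 1) => EX) EF) :
    JetCoord EX EF (k + 1) :=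
  (p.1, Fin.snoc (α := fun m : Fin (k + 2) =>
    ContinuousMultilinearMap ℝ (fun _ : Fin (m : ℕ) => EX) EF) p.2 T)

/-- The coordinates of a `k`-jet as a Taylor series truncated after order `k`. -/
def series (p : JetCoord EX EF k) : FormalMultilinearSeries ℝ EX EF :=
  fun m => if h : m < k + 1 then p.2 ⟨m, h⟩ else 0

/-- The coordinates of the `k`-jet of `u` at `x`. -/
def prolong (k : ℕ) (u : EX → EF) (x : EX) : JetCoord EX EF k :=
  (x, fun m => iteratedFDeriv ℝ (m : ℕ) u x)

@[simp]
theorem top_snoc (p : JetCoord EX EF k)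
    (T : ContinuousMultilinearMap ℝ (fun _ : Fin (k + 1) => EX) EF) : (p.snoc T).top = T :=
  Fin.snoc_last (α := fun m : Fin (k + 2) =>
    ContinuousMultilinearMap ℝ (fun _ : Fin (m : ℕ) => EX) EF) T p.2

@[simp]
theorem init_snoc (p : JetCoord EX EF k)
    (T : ContinuousMultilinearMap ℝ (fun _ : Fin (k + 1) => EX) EF) : (p.snoc T).init = p :=
  Prod.ext rfl (funext fun m => Fin.snoc_castSucc (α := fun m : Fin (k + 2) =>
    ContinuousMultilinearMap ℝ (fun _ : Fin (m : ℕ) => EX) EF) T p.2 m)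

theorem snoc_init_top (p : JetCoord EX EF (k + 1)) : p.init.snoc p.top = p :=
  Prod.ext rfl (Fin.snoc_init_self p.2)

theorem point_init (p : JetCoord EX EF (k + 1)) : p.init.point = p.point := rfl

theorem point_snoc (p : JetCoord EX EF k)
    (T : ContinuousMultilinearMap ℝ (fun _ : Fin (k + 1) => EX) EF) :
    (p.snoc T).point = p.point := by
  rw [← point_init, init_snoc]

theorem point_injective : Function.Injective (point : JetCoord EX EF 0 → EX × EF) := by
  intro p p' h
  obtain ⟨hbase, hfibre⟩ := Prod.mk.inj h
  refine Prod.ext hbase (funext fun m => ?_)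
  obtain rfl : m = 0 := Fin.ext (by omega)
  ext v
  obtain rfl : v = fun _ => 0 := funext fun i => i.elim0
  exact hfibre

theorem series_of_le (p : JetCoord EX EF k) {m : ℕ} (h : m ≤ k) :
    p.series m = p.2 ⟨m, Nat.lt_succ_of_le h⟩ := dif_pos (Nat.lt_succ_of_le h)

theorem series_of_lt (p : JetCoord EX EF k) {m : ℕ} (h : k < m) : p.series m = 0 :=
  dif_neg (by omega)

theorem series_snoc_of_le (p : JetCoord EX EF k)
    (T : ContinuousMultilinearMap ℝ (fun _ : Fin (k + 1) => EX) EF) {m : ℕ} (h : m ≤ k) :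
    (p.snoc T).series m = p.series m := by
  rw [series_of_le _ (by omega), series_of_le _ h]
  exact congrArg (fun p' : JetCoord EX EF k => p'.2 ⟨m, Nat.lt_succ_of_le h⟩) (init_snoc p T)

theorem series_snoc_succ (p : JetCoord EX EF k)
    (T : ContinuousMultilinearMap ℝ (fun _ : Fin (k + 1) => EX) EF) :
    (p.snoc T).series (k + 1) = T :=
  (series_of_le _ le_rfl).trans (top_snoc p T)

theorem series_snoc_sum {ι : Type*} {S : Finset ι} {a : ι → ℝ} (ha : ∑ i ∈ S, a i = 1)
    (p : JetCoord EX EF k)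
    (T : ι → ContinuousMultilinearMap ℝ (fun _ : Fin (k + 1) => EX) EF) (m : ℕ) :
    (p.snoc (∑ i ∈ S, a i • T i)).series m = ∑ i ∈ S, a i • (p.snoc (T i)).series m := by
  rcases lt_trichotomy m (k + 1) with hm | rfl | hm
  · simp only [series_snoc_of_le p _ (Nat.le_of_lt_succ hm), ← Finset.sum_smul, ha, one_smul]
  · simp only [series_snoc_succ]
  · simp only [series_of_lt _ hm, smul_zero, Finset.sum_const_zero]

theorem point_prolong (k : ℕ) (u : EX → EF) (x : EX) : (prolong k u x).point = (x, u x) := rfl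

theorem init_prolong (k : ℕ) (u : EX → EF) (x : EX) :
    (prolong (k + 1) u x).init = prolong k u x := rfl

theorem prolong_congr {u v : EX → EF} {x : EX} (h : u =ᶠ[𝓝 x] v) (k : ℕ) :
    prolong k u x = prolong k v x :=
  Prod.ext rfl (funext fun m => (h.iteratedFDeriv ℝ m).eq_of_nhds)

theorem contDiff_point : ContDiff ℝ ∞ (point : JetCoord EX EF k → EX × EF) := by
  have h : ContDiff ℝ ∞ fun p : JetCoord EX EF k => p.2 0 := contDiff_pi.1 contDiff_snd 0
  refine contDiff_fst.prodMk ?_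
  exact (ContinuousMultilinearMap.apply ℝ _ EF fun _ => (0 : EX)).contDiff.comp h

theorem contDiff_init : ContDiff ℝ ∞ (init : JetCoord EX EF (k + 1) → JetCoord EX EF k) :=
  contDiff_fst.prodMk (contDiff_pi.2 fun m => contDiff_pi.1 contDiff_snd m.castSucc)

theorem contDiff_series (m : ℕ) : ContDiff ℝ ∞ fun p : JetCoord EX EF k => p.series m := by
  rcases le_or_gt m k with h | h
  · simp only [series_of_le _ h]
    exact contDiff_pi.1 contDiff_snd _
  · simp only [series_of_lt _ h]
    exact contDiff_const

theorem contDiff_top : ContDiff ℝ ∞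
    (top : JetCoord EX EF k → ContinuousMultilinearMap ℝ (fun _ : Fin k => EX) EF) :=
  contDiff_pi.1 contDiff_snd _

theorem contDiff_snoc : ContDiff ℝ ∞ fun q : JetCoord EX EF k ×
    ContinuousMultilinearMap ℝ (fun _ : Fin (k + 1) => EX) EF => snoc q.1 q.2 := by
  refine (contDiff_fst.comp contDiff_fst).prodMk (contDiff_pi.2 fun m => ?_)
  induction m using Fin.lastCases with
  | last =>
    simp only [Fin.snoc_last]
    exact contDiff_snd
  | cast m =>
    simp only [Fin.snoc_castSucc]
    exact (contDiff_pi.1 contDiff_snd m).comp contDiff_fst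

/-- The Taylor series of `z ↦ (z, u z)`, where `p` contains the Taylor coefficients of `u`. -/
def graphSeries (p : JetCoord EX EF k) : FormalMultilinearSeries ℝ EX (EX × EF) :=
  fun m => (iteratedFDeriv ℝ m (fun z : EX => z) p.1).prod (p.series m)

theorem graphSeries_snoc_of_le (p : JetCoord EX EF k)
    (T : ContinuousMultilinearMap ℝ (fun _ : Fin (k + 1) => EX) EF) {m : ℕ} (h : m ≤ k) :
    (p.snoc T).graphSeries m = p.graphSeries m := by
  unfold graphSeries
  rw [series_snoc_of_le p T h]
  rfl

theorem graphSeries_snoc_sum {ι : Type*} {S : Finset ι} {a : ι → ℝ} (ha : ∑ i ∈ S, a i = 1)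
    (p : JetCoord EX EF k)
    (T : ι → ContinuousMultilinearMap ℝ (fun _ : Fin (k + 1) => EX) EF) (m : ℕ) :
    (p.snoc (∑ i ∈ S, a i • T i)).graphSeries m = ∑ i ∈ S, a i • (p.snoc (T i)).graphSeries m := by
  ext v
  · simp [graphSeries, snoc, Prod.fst_sum, ← Finset.sum_smul, ha]
  · simp [graphSeries, Prod.snd_sum, series_snoc_sum ha]

theorem graphSeries_prolong {u : EX → EF} {x : EX} (hu : ContDiffAt ℝ ∞ u x) {m : ℕ}
    (h : m ≤ k) :
    (prolong k u x).graphSeries m = iteratedFDeriv ℝ m (fun z => (z, u z)) x := by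
  unfold graphSeries
  rw [series_of_le _ h]
  exact (iteratedFDeriv_prodMk (f := fun z => z) (n := m) contDiffAt_id
    (hu.of_le (mod_cast le_top)) le_rfl).symm

theorem contDiff_graphSeries (m : ℕ) :
    ContDiff ℝ ∞ fun p : JetCoord EX EF k => p.graphSeries m := by
  have hid : ContDiff ℝ ∞ (iteratedFDeriv ℝ m fun z : EX => z) :=
    contDiff_id.iteratedFDeriv_right (m := ∞) (n := ∞) (mod_cast le_top)
  exact (ContinuousMultilinearMap.prodL ℝ (fun _ : Fin m => EX) EX
    EF).toContinuousLinearEquiv.contDiff.comp ((hid.comp contDiff_fst).prodMk (contDiff_series m))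

end JetCoord

theorem LocalSection.jetCoord_eq_prolong {s : LocalSection EX EY π} {c : BundleChart EX EY EF π}
    (hs : s.val ∈ c.total.source) (k : ℕ) :
    s.jetCoord c k = JetCoord.prolong k (s.rep c) (c.base s.pt) :=
  if_pos hs

namespace BundleChart

variable (c c' : BundleChart EX EY EF π) {k : ℕ}

/-- The Taylor series, in the base coordinates of `c`, of the fibre coordinates in `c'` of a
local section with jet coordinates `p` in `c`. -/
def fibreSeries (p : JetCoord EX EF k) : FormalMultilinearSeries ℝ EX EF :=
  (ftaylorSeries ℝ (c.fibreChange c') p.point).taylorComp p.graphSeries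

/-- The transition map of jet coordinates between two bundle charts, given by the Faà di Bruno
formula. -/
def transition (p : JetCoord EX EF k) : JetCoord EX EF k :=
  (c'.base (c.base.symm p.1), fun m => (c.fibreSeries c' p).taylorComp
    (ftaylorSeries ℝ (c.baseChange c') (c'.base (c.base.symm p.1))) m)

variable {c c'}

theorem fibreSeries_prolong {u : EX → EF} {x : EX} (hu : ContDiffAt ℝ ∞ u x)
    (hx : (x, u x) ∈ c.overlap c') {m : ℕ} (h : m ≤ k) :
    c.fibreSeries c' (.prolong k u x) m =
      iteratedFDeriv ℝ m (fun z => c.fibreChange c' (z, u z)) x := by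
  have hgraph : ContDiffAt ℝ m (fun z => (z, u z)) x :=
    contDiffAt_id.prodMk (hu.of_le (mod_cast le_top))
  refine Eq.trans ?_ (iteratedFDeriv_comp (f := fun z => (z, u z)) (n := m)
    ((contDiffAt_fibreChange hx).of_le (mod_cast le_top)) hgraph le_rfl).symm
  exact taylorComp_congr (fun _ _ => rfl) fun j hj =>
    JetCoord.graphSeries_prolong hu (hj.trans h)

theorem transition_prolong {u : EX → EF} {x : EX} (hu : ContDiffAt ℝ ∞ u x)
    (hx : (x, u x) ∈ c.overlap c') :
    c.transition c' (.prolong k u x) = .prolong k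
      ((fun z => c.fibreChange c' (z, u z)) ∘ c.baseChange c') (c'.base (c.base.symm x)) := by
  have hbase := base_symm_fst_mem_of_mem_overlap hx
  have hx' : c.baseChange c' (c'.base (c.base.symm x)) = x := by
    rw [baseChange, c'.base.left_inv hbase, c.base.right_inv (fst_mem_base_target hx.1)]
  have hchange : ContDiffAt ℝ ∞ (c.baseChange c') (c'.base (c.base.symm x)) :=
    contDiffAt_baseChange (c'.base.map_source hbase)
      (by rw [c'.base.left_inv hbase]; exact c.base.map_target (fst_mem_base_target hx.1))
  have hfibre : ContDiffAt ℝ ∞ (fun z => c.fibreChange c' (z, u z)) x :=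
    (contDiffAt_fibreChange hx).comp (f := fun z => (z, u z)) x (contDiffAt_id.prodMk hu)
  refine Prod.ext rfl (funext fun m => Eq.trans ?_ (iteratedFDeriv_comp (n := (m : ℕ))
    (hx'.symm ▸ hfibre.of_le (mod_cast le_top)) (hchange.of_le (mod_cast le_top)) le_rfl).symm)
  refine taylorComp_congr (fun i hi => ?_) fun _ _ => rfl
  rw [hx']
  exact fibreSeries_prolong hu hx (hi.trans (Nat.le_of_lt_succ m.2))

theorem jetCoord_eq_transition {s : LocalSection EX EY π} (hs : s.val ∈ c.total.source)
    (hs' : s.val ∈ c'.total.source) (k : ℕ) :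
    s.jetCoord c' k = c.transition c' (s.jetCoord c k) := by
  rw [LocalSection.jetCoord_eq_prolong hs, LocalSection.jetCoord_eq_prolong hs',
    transition_prolong (LocalSection.eventually_contDiffAt_rep hs).self_of_nhds
      (LocalSection.total_val hs ▸ total_mem_overlap hs hs'),
    c.base.left_inv (LocalSection.pt_mem hs)]
  exact JetCoord.prolong_congr (LocalSection.rep_eventuallyEq hs hs') k

theorem contDiffAt_transition {p : JetCoord EX EF k} (hp : p.point ∈ c.overlap c') :
    ContDiffAt ℝ ∞ (c.transition c' : JetCoord EX EF k → JetCoord EX EF k) p := by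
  have hmem : p.1 ∈ c.base.target := fst_mem_base_target hp.1
  have hmem' : c.base.symm p.1 ∈ c'.base.source := base_symm_fst_mem_of_mem_overlap hp
  have hbase : ContDiffAt ℝ ∞ (fun p : JetCoord EX EF k => c'.base (c.base.symm p.1)) p :=
    (contDiffAt_baseChange hmem hmem').comp p contDiffAt_fst
  have hfibre : ∀ m, ContDiffAt ℝ ∞ (fun p : JetCoord EX EF k => c.fibreSeries c' p m) p :=
    fun m => contDiffAt_taylorComp
      (fun j _ => ((contDiffAt_fibreChange hp).iteratedFDeriv_right (m := ∞) (i := j)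
        (mod_cast le_top)).comp p JetCoord.contDiff_point.contDiffAt)
      fun j _ => (JetCoord.contDiff_graphSeries j).contDiffAt
  have hchange : ContDiffAt ℝ ∞ (c.baseChange c') (c'.base (c.base.symm p.1)) :=
    contDiffAt_baseChange (c'.base.map_source hmem')
      (by rw [c'.base.left_inv hmem']; exact c.base.map_target hmem)
  refine hbase.prodMk (contDiffAt_pi.2 fun m => contDiffAt_taylorComp (fun i _ => hfibre i)
    fun i _ => ?_)
  exact (hchange.iteratedFDeriv_right (m := ∞) (i := i) (mod_cast le_top)).comp p hbase

theorem fibreSeries_snoc_sum {ι : Type*} {S : Finset ι} {a : ι → ℝ} (ha : ∑ i ∈ S, a i = 1)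
    (p : JetCoord EX EF k)
    (T : ι → ContinuousMultilinearMap ℝ (fun _ : Fin (k + 1) => EX) EF) {m : ℕ} (h : m ≤ k + 1) :
    c.fibreSeries c' (p.snoc (∑ i ∈ S, a i • T i)) m =
      ∑ i ∈ S, a i • c.fibreSeries c' (p.snoc (T i)) m := by
  simp only [fibreSeries, JetCoord.point_snoc]
  refine taylorComp_sum_right S a ha _ (fun j hj i _ => ?_) (JetCoord.graphSeries_snoc_sum ha p T m)
  rw [JetCoord.graphSeries_snoc_of_le p _ (by omega),
    JetCoord.graphSeries_snoc_of_le p _ (by omega)]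

theorem top_transition_snoc_sum {ι : Type*} {S : Finset ι} {a : ι → ℝ} (ha : ∑ i ∈ S, a i = 1)
    (p : JetCoord EX EF k) (T : ι → ContinuousMultilinearMap ℝ (fun _ : Fin (k + 1) => EX) EF) :
    (c.transition c' (p.snoc (∑ i ∈ S, a i • T i))).top =
      ∑ i ∈ S, a i • (c.transition c' (p.snoc (T i))).top :=
  taylorComp_sum_left S a _ fun _ hm => fibreSeries_snoc_sum ha p T hm

end BundleChart

namespace BundleChart

section SectionOfRep

variable {c : BundleChart EX EY EF π} {x : EX} {u : EX → EF}

theorem eventually_graph_mem_target (hu : ContDiffAt ℝ ∞ u x) (hx : (x, u x) ∈ c.total.target) :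
    ∀ᶠ z in 𝓝 x, (z, u z) ∈ c.total.target :=
  (continuousAt_id.prodMk hu.continuousAt).eventually (c.total.open_target.mem_nhds hx)

theorem tendsto_base (hx : x ∈ c.base.target) : Tendsto c.base (𝓝 (c.base.symm x)) (𝓝 x) := by
  have := c.base.continuousAt (c.base.map_target hx)
  rwa [ContinuousAt, c.base.right_inv hx] at this

variable (c) in
/-- The local section of `π` whose fibre coordinates in the chart `c` are the function `u`. -/
def sectionOfRep (hu : ∀ᶠ z in 𝓝 x, ContDiffAt ℝ ∞ u z) (hx : (x, u x) ∈ c.total.target) :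
    LocalSection EX EY π where
  pt := c.base.symm x
  toFun b := c.total.symm (c.base b, u (c.base b))
  smooth := by
    have hbase := fst_mem_base_target hx
    filter_upwards [(tendsto_base hbase).eventually
        (hu.and (eventually_graph_mem_target hu.self_of_nhds hx)),
      c.base.open_source.mem_nhds (c.base.map_target hbase)] with b ⟨hub, hmem⟩ hb
    have hcoord := c.base_smooth.contMDiffAt (c.base.open_source.mem_nhds hb)
    exact (c.total_symm_smooth.contMDiffAt (c.total.open_target.mem_nhds hmem)).comp b
      (hcoord.prodMk_space (hub.contMDiffAt.comp b hcoord))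
  isSection := by
    have hbase := fst_mem_base_target hx
    filter_upwards [(tendsto_base hbase).eventually
        (eventually_graph_mem_target hu.self_of_nhds hx),
      c.base.open_source.mem_nhds (c.base.map_target hbase)] with b hmem hb
    rw [← base_symm_fst hmem, c.base.left_inv hb]

variable (hu : ∀ᶠ z in 𝓝 x, ContDiffAt ℝ ∞ u z) (hx : (x, u x) ∈ c.total.target)

theorem sectionOfRep_val : (c.sectionOfRep hu hx).val = c.total.symm (x, u x) := by
  simp only [sectionOfRep, LocalSection.val, c.base.right_inv (fst_mem_base_target hx)]

theorem sectionOfRep_rep : (c.sectionOfRep hu hx).rep c =ᶠ[𝓝 x] u := by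
  filter_upwards [eventually_graph_mem_target hu.self_of_nhds hx] with z hz
  simp only [LocalSection.rep, sectionOfRep, c.base.right_inv (fst_mem_base_target hz),
    c.total.right_inv hz]

theorem sectionOfRep_jetCoord (k : ℕ) :
    (c.sectionOfRep hu hx).jetCoord c k = JetCoord.prolong k u x := by
  rw [LocalSection.jetCoord_eq_prolong (sectionOfRep_val hu hx ▸ c.total.map_target hx)]
  have hpt : c.base (c.sectionOfRep hu hx).pt = x := c.base.right_inv (fst_mem_base_target hx)
  rw [hpt]
  exact JetCoord.prolong_congr (sectionOfRep_rep hu hx) k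

end SectionOfRep

end BundleChart

theorem JetCoord.prolong_sum {ι : Type*} {S : Finset ι} {a : ι → ℝ} (ha : ∑ i ∈ S, a i = 1)
    {k : ℕ} {p : JetCoord EX EF k} {x : EX} {u : ι → EX → EF} (hu : ∀ i, ContDiffAt ℝ ∞ (u i) x)
    (hp : ∀ i, prolong k (u i) x = p) :
    prolong (k + 1) (fun z => ∑ i ∈ S, a i • u i z) x =
      p.snoc (∑ i ∈ S, a i • iteratedFDeriv ℝ (k + 1) (u i) x) := by
  have hderiv (m : ℕ) : iteratedFDeriv ℝ m (fun z => ∑ i ∈ S, a i • u i z) x =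
      ∑ i ∈ S, a i • iteratedFDeriv ℝ m (u i) x := by
    have hm (i : ι) : ContDiffAt ℝ m (u i) x := (hu i).of_le (mod_cast le_top)
    rw [iteratedFDeriv_fun_sum_apply fun i _ => (hm i).const_smul (a i)]
    exact Finset.sum_congr rfl fun i _ => iteratedFDeriv_const_smul_apply' (hm i)
  rw [← snoc_init_top (prolong (k + 1) _ x)]
  refine congrArg₂ snoc ?_ (hderiv (k + 1))
  obtain ⟨i, -⟩ : S.Nonempty := Finset.nonempty_of_sum_ne_zero (ha ▸ one_ne_zero)
  refine Prod.ext (show x = p.1 from congrArg Prod.fst (hp i)) (funext fun m => ?_)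
  have hpm (i : ι) : iteratedFDeriv ℝ (m : ℕ) (u i) x = p.2 m :=
    congrFun (congrArg Prod.snd (hp i)) m
  refine (hderiv m).trans ?_
  simp only [hpm, ← Finset.sum_smul, ha, one_smul]

namespace Jet

variable {c d : BundleChart EX EY EF π} {k : ℕ}

theorem eval_proj (j : Jet EX EY EF π (k + 1)) : j.proj.eval = j.eval := by
  induction j using Quotient.inductionOn with | _ s => rfl

theorem eval_eq_of_proj_eq {j : Jet EX EY EF π k} {J : Jet EX EY EF π (k + 1)}
    (h : J.proj = j) : J.eval = j.eval := by
  rw [← h, eval_proj]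

theorem coord_proj (c : BundleChart EX EY EF π) (j : Jet EX EY EF π (k + 1)) :
    j.proj.coord c = (j.coord c).init := by
  induction j using Quotient.inductionOn with | _ s => ?_
  change s.jetCoord c k = (s.jetCoord c (k + 1)).init
  unfold LocalSection.jetCoord
  split_ifs <;> rfl

theorem coord_eq_snoc (c : BundleChart EX EY EF π) (j : Jet EX EY EF π (k + 1)) :
    j.coord c = (j.proj.coord c).snoc (j.topCoord c) := by
  rw [coord_proj]
  exact (JetCoord.snoc_init_top _).symm

theorem coord_of_notMem {j : Jet EX EY EF π k} (hj : j.eval ∉ c.total.source) :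
    j.coord c = 0 := by
  induction j using Quotient.inductionOn with | _ s => exact if_neg hj

theorem point_coord {j : Jet EX EY EF π k} (hj : j.eval ∈ c.total.source) :
    (j.coord c).point = c.total j.eval := by
  induction j using Quotient.inductionOn with | _ s => ?_
  change (s.jetCoord c k).point = c.total s.val
  rw [LocalSection.jetCoord_eq_prolong hj, JetCoord.point_prolong, LocalSection.total_val hj]

theorem point_coord_mem_overlap {j : Jet EX EY EF π k} (hc : j.eval ∈ c.total.source)
    (hd : j.eval ∈ d.total.source) : (j.coord c).point ∈ c.overlap d :=
  point_coord hc ▸ BundleChart.total_mem_overlap hc hd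

theorem coord_eq_transition {j : Jet EX EY EF π k} (hc : j.eval ∈ c.total.source)
    (hd : j.eval ∈ d.total.source) : j.coord d = c.transition d (j.coord c) := by
  induction j using Quotient.inductionOn with
  | _ s => exact BundleChart.jetCoord_eq_transition hc hd k

theorem ext_coord {j j' : Jet EX EY EF π k} (hj : j.eval ∈ c.total.source)
    (heval : j.eval = j'.eval) (h : j.coord c = j'.coord c) : j = j' := by
  have hcoord (d : BundleChart EX EY EF π) : j.coord d = j'.coord d := by
    by_cases hd : j.eval ∈ d.total.source
    · rw [coord_eq_transition hj hd, h, ← coord_eq_transition (heval ▸ hj) (heval ▸ hd)]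
    · rw [coord_of_notMem hd, coord_of_notMem (heval ▸ hd)]
  induction j using Quotient.inductionOn with | _ s => ?_
  induction j' using Quotient.inductionOn with | _ s' => ?_
  have hval : s.val = s'.val := heval
  exact Quotient.sound ⟨by rw [← s.proj_val, ← s'.proj_val, hval], hval, hcoord⟩

theorem ext_topCoord {j j' : Jet EX EY EF π (k + 1)} (hj : j.eval ∈ c.total.source)
    (hproj : j.proj = j'.proj) (h : j.topCoord c = j'.topCoord c) : j = j' :=
  ext_coord hj (by rw [← eval_proj, hproj, eval_proj])
    (by rw [coord_eq_snoc, coord_eq_snoc, hproj, h])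

theorem exists_rep {j : Jet EX EY EF π k} (hj : j.eval ∈ c.total.source) :
    ∃ u : EX → EF, (∀ᶠ z in 𝓝 (j.coord c).1, ContDiffAt ℝ ∞ u z) ∧
      j.coord c = .prolong k u (j.coord c).1 := by
  induction j using Quotient.inductionOn with | _ s => ?_
  have h : s.jetCoord c k = _ := LocalSection.jetCoord_eq_prolong hj k
  refine ⟨s.rep c, ?_⟩
  change (∀ᶠ z in 𝓝 (s.jetCoord c k).1, _) ∧ s.jetCoord c k = .prolong k _ (s.jetCoord c k).1
  rw [h]
  exact ⟨LocalSection.eventually_contDiffAt_rep hj, rfl⟩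

theorem exists_of_rep {x : EX} {u : EX → EF} (hu : ∀ᶠ z in 𝓝 x, ContDiffAt ℝ ∞ u z)
    (hx : (x, u x) ∈ c.total.target) (k : ℕ) : ∃ j : Jet EX EY EF π k,
      j.eval = c.total.symm (x, u x) ∧ j.coord c = .prolong k u x :=
  ⟨Quotient.mk _ (c.sectionOfRep hu hx), BundleChart.sectionOfRep_val hu hx,
    BundleChart.sectionOfRep_jetCoord hu hx k⟩

theorem exists_succ_of_rep {j : Jet EX EY EF π k} (hj : j.eval ∈ c.total.source) {x : EX}
    {u : EX → EF} (hu : ∀ᶠ z in 𝓝 x, ContDiffAt ℝ ∞ u z) (hju : j.coord c = .prolong k u x) :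
    ∃ J : Jet EX EY EF π (k + 1), J.proj = j ∧ J.coord c = .prolong (k + 1) u x := by
  have hpoint : (x, u x) = c.total j.eval := by
    rw [← point_coord hj, hju, JetCoord.point_prolong]
  obtain ⟨J, heval, hcoord⟩ := exists_of_rep hu (hpoint ▸ c.total.map_source hj) (k + 1)
  rw [hpoint, c.total.left_inv hj] at heval
  refine ⟨J, ext_coord (c := c) ?_ ?_ ?_, hcoord⟩
  · rwa [eval_proj, heval]
  · rw [eval_proj, heval]
  · rw [coord_proj, hcoord, hju, JetCoord.init_prolong]

theorem exists_proj_eq (j : Jet EX EY EF π k) : ∃ J : Jet EX EY EF π (k + 1), J.proj = j := by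
  induction j using Quotient.inductionOn with | _ s => exact ⟨Quotient.mk _ s, rfl⟩

theorem exists_topCoord_eq_zero (c : BundleChart EX EY EF π) (j : Jet EX EY EF π k) :
    ∃ J : Jet EX EY EF π (k + 1), J.proj = j ∧ J.topCoord c = 0 := by
  by_cases hj : j.eval ∈ c.total.source
  · obtain ⟨u, hu, hju⟩ := exists_rep hj
    obtain ⟨v, hv, hv_top, hvu⟩ := exists_iteratedFDeriv_eq_zero hu (k + 1)
    have hjv : j.coord c = .prolong k v (j.coord c).1 :=
      hju.trans (Prod.ext rfl (funext fun m => (hvu m m.2).symm))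
    obtain ⟨J, hJ, hJv⟩ := exists_succ_of_rep hj hv hjv
    exact ⟨J, hJ, (congrArg JetCoord.top hJv).trans hv_top⟩
  · obtain ⟨J, hJ⟩ := exists_proj_eq j
    refine ⟨J, hJ, congrArg JetCoord.top (coord_of_notMem ?_)⟩
    rwa [← eval_proj, hJ]

section AffineFibre

variable {ι : Type*} {S : Finset ι} {a : ι → ℝ} {j : Jet EX EY EF π k}
  {J : ι → Jet EX EY EF π (k + 1)}

theorem exists_topCoord_eq_sum (ha : ∑ i ∈ S, a i = 1) (hj : j.eval ∈ c.total.source)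
    (hJ : ∀ i, (J i).proj = j) : ∃ K : Jet EX EY EF π (k + 1),
      K.proj = j ∧ K.topCoord c = ∑ i ∈ S, a i • (J i).topCoord c := by
  have hbase (i : ι) : ((J i).coord c).1 = (j.coord c).1 := by rw [← hJ i, coord_proj]; rfl
  choose u hu hJu using fun i =>
    exists_rep (c := c) (j := J i) (eval_eq_of_proj_eq (hJ i) ▸ hj)
  simp only [hbase] at hu hJu
  have hju (i : ι) : JetCoord.prolong k (u i) (j.coord c).1 = j.coord c := by
    rw [← JetCoord.init_prolong, ← hJu, ← coord_proj, hJ]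
  have hprolong := JetCoord.prolong_sum ha (fun i => (hu i).self_of_nhds) hju
  have hsmooth : ∀ᶠ z in 𝓝 (j.coord c).1, ContDiffAt ℝ ∞ (fun z => ∑ i ∈ S, a i • u i z) z := by
    filter_upwards [(Finset.eventually_all S).2 fun i _ => hu i] with z hz
    exact ContDiffAt.sum fun i hi => (hz i hi).const_smul (a i)
  obtain ⟨K, hK, hKu⟩ := exists_succ_of_rep hj hsmooth
    (by rw [← JetCoord.init_prolong, hprolong, JetCoord.init_snoc])
  refine ⟨K, hK, ?_⟩
  have htop (i : ι) : (J i).topCoord c = iteratedFDeriv ℝ (k + 1) (u i) (j.coord c).1 :=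
    congrArg JetCoord.top (hJu i)
  simp only [htop]
  rw [topCoord, hKu, hprolong]
  exact JetCoord.top_snoc _ _

theorem topCoord_eq_sum_of_topCoord_eq_sum {K : Jet EX EY EF π (k + 1)}
    (ha : ∑ i ∈ S, a i = 1) (hK : K.proj = j) (hJ : ∀ i, (J i).proj = j)
    (hc : j.eval ∈ c.total.source) (hd : j.eval ∈ d.total.source)
    (h : K.topCoord c = ∑ i ∈ S, a i • (J i).topCoord c) :
    K.topCoord d = ∑ i ∈ S, a i • (J i).topCoord d := by
  have htop {L : Jet EX EY EF π (k + 1)} (hL : L.proj = j) :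
      L.topCoord d = (c.transition d ((j.coord c).snoc (L.topCoord c))).top := by
    have heval := eval_eq_of_proj_eq hL
    rw [← hL, ← coord_eq_snoc, ← coord_eq_transition (heval ▸ hc) (heval ▸ hd)]
    rfl
  simp only [htop hK, fun i => htop (hJ i), h, BundleChart.top_transition_snoc_sum ha]

/-- Transition maps are affine in the top order coordinates, hence affine combinations in the
fibres of `J^{k+1} Y → J^k Y` do not depend on the chart. -/
theorem exists_affineCombination (hπ : IsFibredManifold EX EY EF π) (ha : ∑ i ∈ S, a i = 1)
    (hJ : ∀ i, (J i).proj = j) : ∃ K : Jet EX EY EF π (k + 1), K.proj = j ∧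
      ∀ c : BundleChart EX EY EF π, K.topCoord c = ∑ i ∈ S, a i • (J i).topCoord c := by
  obtain ⟨c, hc⟩ := hπ j.eval
  obtain ⟨K, hK, hsum⟩ := exists_topCoord_eq_sum ha hc hJ
  refine ⟨K, hK, fun d => ?_⟩
  by_cases hd : j.eval ∈ d.total.source
  · exact topCoord_eq_sum_of_topCoord_eq_sum ha hK hJ hc hd hsum
  · have hzero {L : Jet EX EY EF π (k + 1)} (hL : L.proj = j) : L.topCoord d = 0 :=
      congrArg JetCoord.top (coord_of_notMem (eval_eq_of_proj_eq hL ▸ hd))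
    simp only [hzero hK, fun i => hzero (hJ i), smul_zero, Finset.sum_const_zero]

end AffineFibre

end Jet

/-- The coordinates of the `0`-jet over the point of `Y` with coordinates `q`. -/
def JetCoord.ofPoint (q : EX × EF) : JetCoord EX EF 0 := prolong 0 (fun _ => q.2) q.1

theorem JetCoord.ofPoint_point (p : JetCoord EX EF 0) : ofPoint p.point = p := point_injective rfl

theorem JetCoord.continuous_ofPoint : Continuous (ofPoint : EX × EF → JetCoord EX EF 0) := by
  refine continuous_fst.prodMk (continuous_pi fun m => ?_)
  obtain rfl : m = 0 := Fin.ext (by omega)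
  exact (continuousMultilinearCurryFin0 ℝ EX EF).symm.continuous.comp continuous_snd

namespace Jet

variable {c d : BundleChart EX EY EF π} {k : ℕ}

theorem isOpen_coord_preimage (c : BundleChart EX EY EF π) {W : Set (JetCoord EX EF k)}
    (hW : IsOpen W) :
    IsOpen {j : Jet EX EY EF π k | j.eval ∈ c.total.source ∧ j.coord c ∈ W} :=
  TopologicalSpace.isOpen_generateFrom_of_mem ⟨c, W, hW, rfl⟩

theorem eventually_eval_mem {j : Jet EX EY EF π k} (hj : j.eval ∈ c.total.source) :
    ∀ᶠ j' : Jet EX EY EF π k in 𝓝 j, j'.eval ∈ c.total.source := by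
  filter_upwards [(isOpen_coord_preimage c isOpen_univ).mem_nhds ⟨hj, mem_univ _⟩]
    with j' h using h.1

theorem continuousAt_coord {j : Jet EX EY EF π k} (hj : j.eval ∈ c.total.source) :
    ContinuousAt (coord c) j := by
  intro U hU
  obtain ⟨W, hWU, hW, hjW⟩ := mem_nhds_iff.1 hU
  exact mem_map.2 (mem_of_superset ((isOpen_coord_preimage c hW).mem_nhds ⟨hj, hjW⟩)
    fun j' h => hWU h.2)

theorem continuousAt_topCoord {j : Jet EX EY EF π k} (hj : j.eval ∈ c.total.source) :
    ContinuousAt (topCoord c) j :=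
  JetCoord.contDiff_top.continuous.continuousAt.comp (continuousAt_coord hj)

theorem continuous_eval (hπ : IsFibredManifold EX EY EF π) :
    Continuous (eval : Jet EX EY EF π k → Y) := by
  refine continuous_iff_continuousAt.2 fun j => ?_
  obtain ⟨c, hj⟩ := hπ j.eval
  have hpoint : ContinuousAt (fun j' : Jet EX EY EF π k => (j'.coord c).point) j :=
    JetCoord.contDiff_point.continuous.continuousAt.comp (continuousAt_coord hj)
  have hsymm : ContinuousAt (fun j' : Jet EX EY EF π k => c.total.symm (j'.coord c).point) j := by
    refine ContinuousAt.comp (g := c.total.symm) ?_ hpoint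
    rw [point_coord hj]
    exact c.total.continuousAt_symm (c.total.map_source hj)
  refine hsymm.congr ?_
  filter_upwards [eventually_eval_mem hj] with j' hj'
  rw [point_coord hj', c.total.left_inv hj']

section ContinuousAt

variable {Z : Type*} [TopologicalSpace Z] {z : Z}

theorem continuousAt_of_coord {g : Z → Jet EX EY EF π k} (hz : (g z).eval ∈ c.total.source)
    (heval : ContinuousAt (fun w => (g w).eval) z)
    (hcoord : ContinuousAt (fun w => (g w).coord c) z) : ContinuousAt g z := by
  refine TopologicalSpace.tendsto_nhds_generateFrom_iff.2 ?_
  rintro _ ⟨d, W, hW, rfl⟩ ⟨hd, hdW⟩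
  have htransition : ContinuousAt (fun w => c.transition d ((g w).coord c)) z :=
    ContinuousAt.comp (g := c.transition d)
      (BundleChart.contDiffAt_transition (point_coord_mem_overlap hz hd)).continuousAt hcoord
  rw [coord_eq_transition hz hd] at hdW
  filter_upwards [heval.eventually (c.total.open_source.mem_nhds hz),
    heval.eventually (d.total.open_source.mem_nhds hd),
    htransition.eventually (hW.mem_nhds hdW)] with w hwc hwd hwW
  exact ⟨hwd, (coord_eq_transition hwc hwd).symm ▸ hwW⟩

theorem continuousAt_of_topCoord {g : Z → Jet EX EY EF π (k + 1)}
    (hπ : IsFibredManifold EX EY EF π) (hz : (g z).eval ∈ c.total.source)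
    (hproj : ContinuousAt (fun w => (g w).proj) z)
    (htop : ContinuousAt (fun w => (g w).topCoord c) z) : ContinuousAt g z := by
  refine continuousAt_of_coord hz ?_ ?_
  · simp only [← eval_proj]
    exact (continuous_eval hπ).continuousAt.comp hproj
  · simp only [coord_eq_snoc]
    have hcoord : ContinuousAt (fun w => (g w).proj.coord c) z :=
      (continuousAt_coord (eval_proj (g z) ▸ hz)).comp hproj
    exact JetCoord.contDiff_snoc.continuous.continuousAt.comp (hcoord.prodMk htop)

end ContinuousAt

theorem eval_injective (hπ : IsFibredManifold EX EY EF π) :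
    Function.Injective (eval : Jet EX EY EF π 0 → Y) := by
  intro j j' h
  obtain ⟨c, hj⟩ := hπ j.eval
  refine ext_coord hj h (JetCoord.point_injective ?_)
  rw [point_coord hj, point_coord (h ▸ hj), h]

theorem eval_surjective (hπ : IsFibredManifold EX EY EF π) :
    Function.Surjective (eval : Jet EX EY EF π 0 → Y) := by
  intro y
  obtain ⟨c, hy⟩ := hπ y
  obtain ⟨j, hj, -⟩ := exists_of_rep (c := c) (x := (c.total y).1) (u := fun _ => (c.total y).2)
    (Eventually.of_forall fun _ => contDiffAt_const) (c.total.map_source hy) 0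
  exact ⟨j, hj.trans (c.total.left_inv hy)⟩

theorem continuous_of_comp_eval {Z : Type*} [TopologicalSpace Z] {g : Z → Jet EX EY EF π 0}
    (hπ : IsFibredManifold EX EY EF π) (hg : Continuous fun z => (g z).eval) : Continuous g := by
  refine continuous_iff_continuousAt.2 fun z => ?_
  obtain ⟨c, hz⟩ := hπ (g z).eval
  have hchart : ContinuousAt (fun w => c.total (g w).eval) z :=
    ContinuousAt.comp (f := fun w => (g w).eval) (c.total.continuousAt hz) hg.continuousAt
  refine continuousAt_of_coord hz hg.continuousAt ?_
  refine (JetCoord.continuous_ofPoint.continuousAt.comp hchart).congr ?_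
  filter_upwards [hg.continuousAt.eventually (c.total.open_source.mem_nhds hz)] with w hw
  rw [← JetCoord.ofPoint_point ((g w).coord c), point_coord hw]
  rfl

/-- The identification `J^0 Y = Y`. -/
def evalHomeomorph (hπ : IsFibredManifold EX EY EF π) : Jet EX EY EF π 0 ≃ₜ Y where
  toEquiv := Equiv.ofBijective eval ⟨eval_injective hπ, eval_surjective hπ⟩
  continuous_toFun := continuous_eval hπ
  continuous_invFun := continuous_of_comp_eval hπ <|
    continuous_id.congr fun y => (Equiv.ofBijective_apply_symm_apply eval
      ⟨eval_injective hπ, eval_surjective hπ⟩ y).symm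

theorem eval_evalHomeomorph_symm (hπ : IsFibredManifold EX EY EF π) (y : Y) :
    ((evalHomeomorph hπ).symm y).eval = y :=
  (evalHomeomorph hπ).apply_symm_apply y

end Jet

theorem BundleChart.point_transition {c c' : BundleChart EX EY EF π} {k : ℕ}
    {p : JetCoord EX EF k} (hp : p.point ∈ c.overlap c') :
    (c.transition c' p).point = c'.total (c.total.symm p.point) := by
  refine Prod.ext ?_ ?_
  · rw [c'.fst_eq _ hp.2, ← base_symm_fst hp.1]
    rfl
  · refine (taylorComp_zero_apply (c.fibreSeries c' p) _ _ fun _ => 0).trans ?_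
    refine (taylorComp_zero_apply (ftaylorSeries ℝ (c.fibreChange c') p.point) _ _
      fun _ => 0).trans ?_
    exact iteratedFDeriv_zero_apply (𝕜 := ℝ) (f := c.fibreChange c') _

namespace Jet

variable {c d : BundleChart EX EY EF π} {k : ℕ}

/-- The coordinate expression in the chart `c` of the section of `J^{k+1} Y → J^k Y` whose
coordinates of top order in the chart `d` vanish. -/
def zeroTopCoord (d c : BundleChart EX EY EF π) (p : JetCoord EX EF k) :
    ContinuousMultilinearMap ℝ (fun _ : Fin (k + 1) => EX) EF :=
  (d.transition c ((c.transition d p).snoc 0)).top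

theorem topCoord_eq_zeroTopCoord {J : Jet EX EY EF π (k + 1)} (hd : J.eval ∈ d.total.source)
    (hc : J.eval ∈ c.total.source) (hJ : J.topCoord d = 0) :
    J.topCoord c = zeroTopCoord d c (J.proj.coord c) := by
  have heval := eval_proj J
  rw [zeroTopCoord, ← coord_eq_transition (heval ▸ hc) (heval ▸ hd), ← hJ, ← coord_eq_snoc,
    ← coord_eq_transition hd hc]
  rfl

theorem contDiffAt_zeroTopCoord {p : JetCoord EX EF k} (hp : p.point ∈ c.overlap d) :
    ContDiffAt ℝ ∞ (zeroTopCoord d c) p := by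
  have hsnoc : ContDiffAt ℝ ∞ (fun p : JetCoord EX EF k => (c.transition d p).snoc 0) p :=
    JetCoord.contDiff_snoc.contDiffAt.comp p
      ((BundleChart.contDiffAt_transition hp).prodMk contDiffAt_const)
  have hmem : ((c.transition d p).snoc 0).point ∈ d.overlap c := by
    rw [JetCoord.point_snoc, BundleChart.point_transition hp]
    exact BundleChart.total_mem_overlap hp.2 (c.total.map_target hp.1)
  exact JetCoord.contDiff_top.contDiffAt.comp p (ContDiffAt.comp (g := d.transition c) p
    (BundleChart.contDiffAt_transition hmem) hsnoc)

theorem isSmoothJetSection_of_topCoord (hπ : IsFibredManifold EX EY EF π)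
    {Γ : Jet EX EY EF π k → Jet EX EY EF π (k + 1)} (hproj : ∀ j, (Γ j).proj = j)
    (htop : ∀ c : BundleChart EX EY EF π,
      ∃ T : JetCoord EX EF k → ContinuousMultilinearMap ℝ (fun _ : Fin (k + 1) => EX) EF,
        (∀ p ∈ c.jetTarget k, ContDiffAt ℝ ∞ T p) ∧
        ∀ j : Jet EX EY EF π k, j.eval ∈ c.total.source → (Γ j).topCoord c = T (j.coord c)) :
    IsSmoothJetSection Γ where
  proj_apply := hproj
  continuous := by
    refine continuous_iff_continuousAt.2 fun j => ?_
    obtain ⟨c, hj⟩ := hπ j.eval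
    obtain ⟨T, hT, hΓT⟩ := htop c
    have hmem : j.coord c ∈ c.jetTarget k :=
      show (j.coord c).point ∈ _ from point_coord hj ▸ c.total.map_source hj
    refine continuousAt_of_topCoord hπ (eval_eq_of_proj_eq (hproj j) ▸ hj) ?_ ?_
    · simpa only [hproj] using continuousAt_id' j
    · refine ((hT _ hmem).continuousAt.comp (continuousAt_coord hj)).congr ?_
      filter_upwards [eventually_eval_mem hj] with j' hj' using (hΓT j' hj').symm
  smooth_coord c := by
    obtain ⟨T, hT, hΓT⟩ := htop c
    refine ⟨fun p => p.snoc (T p), fun p hp => ContDiffAt.contDiffWithinAt ?_, fun j hj => ?_⟩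
    · exact JetCoord.contDiff_snoc.contDiffAt.comp p (contDiffAt_id.prodMk (hT p hp))
    · rw [coord_eq_snoc, hproj, hΓT j hj]

section PartitionOfUnity

variable {ι : Type*} (ρ : SmoothPartitionOfUnity ι 𝓘(ℝ, EY) Y univ)
  (ch : ι → BundleChart EX EY EF π)

/-- The coordinates of top order in the chart `c` of the section of `J^{k+1} Y → J^k Y` glued by
means of the partition of unity `ρ` from the sections whose coordinates of top order in the charts
`ch i` vanish. -/
def gluedTopCoord (c : BundleChart EX EY EF π) (p : JetCoord EX EF k) :
    ContinuousMultilinearMap ℝ (fun _ : Fin (k + 1) => EX) EF :=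
  ∑ᶠ i, ρ i (c.total.symm p.point) • zeroTopCoord (ch i) c p

variable {ρ ch}

theorem contDiffAt_gluedTopCoord (hρ : ρ.IsSubordinate fun i => (ch i).total.source)
    {p : JetCoord EX EF k} (hp : p ∈ c.jetTarget k) :
    ContDiffAt ℝ ∞ (gluedTopCoord ρ ch c) p := by
  have hpoint : ContDiffAt ℝ ∞ (fun p : JetCoord EX EF k => p.point) p :=
    JetCoord.contDiff_point.contDiffAt
  have hlim : ContinuousAt (fun p : JetCoord EX EF k => c.total.symm p.point) p :=
    ContinuousAt.comp (g := c.total.symm) (c.total.continuousAt_symm hp) hpoint.continuousAt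
  have hweight (i : ι) :
      ContDiffAt ℝ ∞ (fun p : JetCoord EX EF k => ρ i (c.total.symm p.point)) p := by
    refine ContDiffAt.comp (g := fun q => ρ i (c.total.symm q)) p ?_ hpoint
    rw [← contMDiffAt_iff_contDiffAt]
    exact (ρ i).contMDiff.contMDiffAt.comp p.point
      (c.total_symm_smooth.contMDiffAt (c.total.open_target.mem_nhds hp))
  have hsum : ContDiffAt ℝ ∞ (fun p' => ∑ i ∈ ρ.fintsupport (c.total.symm p.point),
      ρ i (c.total.symm p'.point) • zeroTopCoord (ch i) c p') p :=
    ContDiffAt.sum fun i hi => (hweight i).smul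
      (contDiffAt_zeroTopCoord ⟨hp, hρ i ((ρ.mem_fintsupport_iff _ i).1 hi)⟩)
  refine hsum.congr_of_eventuallyEq ?_
  filter_upwards [hlim.eventually (ρ.eventually_finsupport_subset _)] with p' hp'
  refine finsum_eq_sum_of_support_subset _ fun i hi => hp' ?_
  rw [ρ.mem_finsupport]
  exact left_ne_zero_of_smul hi

theorem gluedTopCoord_coord (hρ : ρ.IsSubordinate fun i => (ch i).total.source)
    {j : Jet EX EY EF π k} (hj : j.eval ∈ c.total.source) {J : ι → Jet EX EY EF π (k + 1)}
    (hJ : ∀ i, (J i).proj = j) (hJ_top : ∀ i, (J i).topCoord (ch i) = 0) :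
    gluedTopCoord ρ ch c (j.coord c) =
      ∑ i ∈ ρ.finsupport j.eval, ρ i j.eval • (J i).topCoord c := by
  rw [gluedTopCoord, point_coord hj, c.total.left_inv hj,
    ← ρ.sum_finsupport_smul_eq_finsum j.eval fun i _ => zeroTopCoord (ch i) c (j.coord c)]
  refine Finset.sum_congr rfl fun i hi => ?_
  have heval := eval_eq_of_proj_eq (hJ i)
  have hi' : j.eval ∈ (ch i).total.source :=
    hρ i (subset_closure ((ρ.mem_finsupport j.eval).1 hi))
  rw [topCoord_eq_zeroTopCoord (heval ▸ hi') (heval ▸ hj) (hJ_top i), hJ]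

end PartitionOfUnity

theorem exists_isSmoothJetSection [FiniteDimensional ℝ EY] [IsManifold 𝓘(ℝ, EY) ∞ Y] [T2Space Y]
    [SigmaCompactSpace Y] (hπ : IsFibredManifold EX EY EF π) (k : ℕ) :
    ∃ Γ : Jet EX EY EF π k → Jet EX EY EF π (k + 1), IsSmoothJetSection Γ := by
  choose ch hch using fun y => hπ y
  obtain ⟨ρ, hρ⟩ := SmoothPartitionOfUnity.exists_isSubordinate 𝓘(ℝ, EY) (s := (univ : Set Y))
    isClosed_univ (fun y => (ch y).total.source) (fun y => (ch y).total.open_source)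
    fun y _ => mem_iUnion.2 ⟨y, hch y⟩
  choose J hJ hJ_top using fun y => exists_topCoord_eq_zero (k := k) (ch y)
  choose Γ hΓ hΓ_top using fun j : Jet EX EY EF π k => exists_affineCombination hπ
    (ρ.sum_finsupport j.eval (mem_univ _)) fun i => hJ i j
  refine ⟨Γ, isSmoothJetSection_of_topCoord hπ hΓ fun c =>
    ⟨gluedTopCoord ρ ch c, fun p hp => contDiffAt_gluedTopCoord hρ hp, fun j hj => ?_⟩⟩
  rw [hΓ_top, gluedTopCoord_coord hρ hj (fun i => hJ i j) fun i => hJ_top i j]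

end Jet

theorem exists_smooth_isStepFamily :
    ∃ f : ℕ → ℝ → ℝ, IsStepFamily f ∧ ∀ k, ContDiff ℝ ∞ (f k) := by
  have hsmooth (k : ℕ) : ContDiff ℝ ∞ fun t : ℝ =>
      Real.smoothTransition ((t - (1 - (1 / 2) ^ k)) * 2 ^ (k + 1)) :=
    Real.smoothTransition.contDiff.comp (by fun_prop)
  refine ⟨_, ⟨fun k _ => (hsmooth k).continuous.continuousOn, fun k _ t _ ht => ?_,
    fun k _ t _ ht => ?_⟩, hsmooth⟩
  · exact Real.smoothTransition.zero_of_nonpos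
      (mul_nonpos_of_nonpos_of_nonneg (by linarith) (by positivity))
  · refine Real.smoothTransition.one_of_one_le ?_
    have hstep : (1 / 2 : ℝ) ^ (k + 1) ≤ t - (1 - (1 / 2) ^ k) := by
      linarith [pow_succ (1 / 2 : ℝ) k]
    calc (1 : ℝ) = (1 / 2) ^ (k + 1) * 2 ^ (k + 1) := by rw [← mul_pow]; norm_num
      _ ≤ _ := mul_le_mul_of_nonneg_right hstep (by positivity)

/-- The weights, indexed by the orders `k ≥ 1`, of the homotopy at a fixed time: no order has a
nonzero weight before all lower orders have weight `1`. -/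
def IsCutoff (a : ℕ → ℝ) : Prop :=
  ∀ k m, 1 ≤ m → m ≤ k → a (k + 1) ≠ 0 → a m = 1

namespace IsStepFamily

variable {f : ℕ → ℝ → ℝ}

theorem isCutoff (hf : IsStepFamily f) {t : ℝ} (ht : t ∈ Icc (0 : ℝ) 1) :
    IsCutoff fun k => f k t := by
  intro k m hm hmk hne
  have hlt : 1 - (1 / 2 : ℝ) ^ (k + 1) < t := by
    by_contra! hle
    exact hne (hf.eq_zero (k + 1) (by omega) t ht hle)
  refine hf.eq_one m hm t ht (le_trans ?_ hlt.le)
  have : (1 / 2 : ℝ) ^ (k + 1) ≤ (1 / 2) ^ (m + 1) :=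
    pow_le_pow_of_le_one (by norm_num) (by norm_num) (by omega)
  linarith

theorem apply_zero (hf : IsStepFamily f) {k : ℕ} (hk : 1 ≤ k) : f k 0 = 0 := by
  refine hf.eq_zero k hk 0 (left_mem_Icc.2 zero_le_one) (sub_nonneg.2 ?_)
  exact pow_le_one₀ (by norm_num) (by norm_num)

theorem apply_one (hf : IsStepFamily f) {k : ℕ} (hk : 1 ≤ k) : f k 1 = 1 :=
  hf.eq_one k hk 1 (right_mem_Icc.2 zero_le_one) (sub_le_self _ (by positivity))

end IsStepFamily

namespace Jet

variable {k : ℕ}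

open Classical in
/-- The affine combination `a J + (1 - a) J'` in a fibre of `J^{k+1} Y → J^k Y`. For `a = 0`
the two jets may lie in different fibres; for `a ≠ 0` the value is junk if they do. -/
def combination (a : ℝ) (J J' : Jet EX EY EF π (k + 1)) : Jet EX EY EF π (k + 1) :=
  if h : ∃ K : Jet EX EY EF π (k + 1), K.proj = J'.proj ∧ ∀ c : BundleChart EX EY EF π,
    K.topCoord c = a • J.topCoord c + (1 - a) • J'.topCoord c then h.choose else J'

variable {a : ℝ} {J J' : Jet EX EY EF π (k + 1)}

theorem proj_combination (a : ℝ) (J J' : Jet EX EY EF π (k + 1)) :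
    (combination a J J').proj = J'.proj := by
  unfold combination
  split_ifs with h
  · exact h.choose_spec.1
  · rfl

theorem topCoord_combination (hπ : IsFibredManifold EX EY EF π) (h : a ≠ 0 → J.proj = J'.proj)
    (c : BundleChart EX EY EF π) :
    (combination a J J').topCoord c = a • J.topCoord c + (1 - a) • J'.topCoord c := by
  have hex : ∃ K : Jet EX EY EF π (k + 1), K.proj = J'.proj ∧ ∀ c : BundleChart EX EY EF π,
      K.topCoord c = a • J.topCoord c + (1 - a) • J'.topCoord c := by
    rcases eq_or_ne a 0 with rfl | ha
    · exact ⟨J', rfl, fun c => by simp⟩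
    · simpa [Fin.forall_fin_two, h ha] using exists_affineCombination hπ (S := Finset.univ)
        (a := ![a, 1 - a]) (j := J'.proj) (J := ![J, J']) (by simp)
  rw [combination, dif_pos hex]
  exact hex.choose_spec.2 c

theorem combination_eq (hπ : IsFibredManifold EX EY EF π) (h : a ≠ 0 → J.proj = J'.proj)
    {K : Jet EX EY EF π (k + 1)} (hK : K.proj = J'.proj)
    (htop : ∀ c : BundleChart EX EY EF π,
      K.topCoord c = a • J.topCoord c + (1 - a) • J'.topCoord c) : combination a J J' = K := by
  obtain ⟨c, hc⟩ := hπ (combination a J J').eval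
  exact ext_topCoord hc ((proj_combination a J J').trans hK.symm)
    ((topCoord_combination hπ h c).trans (htop c).symm)

theorem combination_zero (hπ : IsFibredManifold EX EY EF π) (J J' : Jet EX EY EF π (k + 1)) :
    combination 0 J J' = J' :=
  combination_eq hπ (fun h => (h rfl).elim) rfl fun c => by simp

theorem combination_one (hπ : IsFibredManifold EX EY EF π) (h : J.proj = J'.proj) :
    combination 1 J J' = J :=
  combination_eq hπ (fun _ => h) h fun c => by simp

theorem combination_self (hπ : IsFibredManifold EX EY EF π) (a : ℝ)
    (J : Jet EX EY EF π (k + 1)) : combination a J J = J :=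
  combination_eq hπ (fun _ => rfl) rfl fun c => by simp [← add_smul]

theorem continuous_proj (hπ : IsFibredManifold EX EY EF π) :
    Continuous (proj : Jet EX EY EF π (k + 1) → Jet EX EY EF π k) := by
  refine continuous_iff_continuousAt.2 fun j => ?_
  obtain ⟨c, hj⟩ := hπ j.eval
  refine continuousAt_of_coord (c := c) (eval_proj j ▸ hj) ?_ ?_
  · simpa only [eval_proj] using (continuous_eval hπ).continuousAt
  · simp only [coord_proj]
    exact JetCoord.contDiff_init.continuous.continuousAt.comp (continuousAt_coord hj)

theorem continuous_combination (hπ : IsFibredManifold EX EY EF π) {Z : Type*} [TopologicalSpace Z]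
    {a : Z → ℝ} {J J' : Z → Jet EX EY EF π (k + 1)} (ha : Continuous a) (hJ : Continuous J)
    (hJ' : Continuous J') (heval : ∀ z, (J z).eval = (J' z).eval)
    (hproj : ∀ z, a z ≠ 0 → (J z).proj = (J' z).proj) :
    Continuous fun z => combination (a z) (J z) (J' z) := by
  refine continuous_iff_continuousAt.2 fun z => ?_
  obtain ⟨c, hc⟩ := hπ (J' z).eval
  refine continuousAt_of_topCoord (c := c) hπ ?_ ?_ ?_
  · rwa [← eval_proj, proj_combination, eval_proj]
  · simp only [proj_combination]
    exact ((continuous_proj hπ).comp hJ').continuousAt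
  · simp only [topCoord_combination hπ (hproj _)]
    have htop : ContinuousAt (fun w => (J w).topCoord c) z :=
      (continuousAt_topCoord (heval z ▸ hc)).comp hJ.continuousAt
    have htop' : ContinuousAt (fun w => (J' w).topCoord c) z :=
      (continuousAt_topCoord hc).comp hJ'.continuousAt
    exact (ha.continuousAt.smul htop).add ((continuousAt_const.sub ha.continuousAt).smul htop')

end Jet

namespace JetInf

theorem eval_apply (q : JetInf EX EY EF π) (k : ℕ) : (q.1 k).eval = q.eval := by
  induction k with
  | zero => rfl
  | succ k ih => rw [← Jet.eval_proj, q.2 k, ih]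

theorem continuous_apply (k : ℕ) : Continuous fun q : JetInf EX EY EF π => q.1 k :=
  (_root_.continuous_apply k).comp continuous_subtype_val

theorem continuous_eval (hπ : IsFibredManifold EX EY EF π) :
    Continuous (eval : JetInf EX EY EF π → Y) :=
  (Jet.continuous_eval hπ).comp (continuous_apply 0)

theorem evalHomeomorph_symm_eval (hπ : IsFibredManifold EX EY EF π) (q : JetInf EX EY EF π) :
    (Jet.evalHomeomorph hπ).symm q.eval = q.1 0 :=
  (Jet.evalHomeomorph hπ).symm_apply_apply (q.1 0)

variable {Γ : (k : ℕ) → Jet EX EY EF π k → Jet EX EY EF π (k + 1)}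

/-- The global section `γ` of `π^∞_0` with `π^∞_k ∘ γ = Γ_(k) ∘ ⋯ ∘ Γ_(1)`. The section `Γ_(k + 1)`
of `J^{k+1} Y → J^k Y` is denoted by `Γ k`. -/
def ofSections (hπ : IsFibredManifold EX EY EF π) (hΓ : ∀ k, IsContinuousJetSection (Γ k)) (y : Y) :
    JetInf EX EY EF π :=
  ⟨fun k => Nat.rec ((Jet.evalHomeomorph hπ).symm y) Γ k, fun k => (hΓ k).proj_apply _⟩

/-- The jet of order `k` of the deformation with weights `a`: its coordinates of order `m ≥ 1` are
`a m` times those of `q` plus `1 - a m` times those given by the section `Γ (m - 1)`. -/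
def deformJet (Γ : (k : ℕ) → Jet EX EY EF π k → Jet EX EY EF π (k + 1)) (a : ℕ → ℝ)
    (q : JetInf EX EY EF π) : (k : ℕ) → Jet EX EY EF π k
  | 0 => q.1 0
  | k + 1 => Jet.combination (a (k + 1)) (q.1 (k + 1)) (Γ k (deformJet Γ a q k))

/-- The deformation of `q` towards the section `ofSections` with weights `a`. -/
def deform (hΓ : ∀ k, IsContinuousJetSection (Γ k)) (a : ℕ → ℝ) (q : JetInf EX EY EF π) :
    JetInf EX EY EF π :=
  ⟨deformJet Γ a q, fun k => (Jet.proj_combination _ _ _).trans ((hΓ k).proj_apply _)⟩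

section

variable (hπ : IsFibredManifold EX EY EF π) (hΓ : ∀ k, IsContinuousJetSection (Γ k))
include hπ

theorem eval_ofSections (y : Y) : (ofSections hπ hΓ y).eval = y :=
  Jet.eval_evalHomeomorph_symm hπ y

theorem continuous_ofSections : Continuous (ofSections hπ hΓ) := by
  refine Continuous.subtype_mk (continuous_pi fun k => ?_) _
  induction k with
  | zero => exact (Jet.evalHomeomorph hπ).symm.continuous
  | succ k ih => exact (hΓ k).continuous.comp ih

variable {a : ℕ → ℝ} {q : JetInf EX EY EF π}

include hΓ in
theorem deformJet_eq_apply {k : ℕ} (ha : ∀ m, 1 ≤ m → m ≤ k → a m = 1) :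
    deformJet Γ a q k = q.1 k := by
  induction k with
  | zero => rfl
  | succ k ih =>
    rw [deformJet, ha (k + 1) (by omega) le_rfl]
    refine Jet.combination_one hπ ?_
    rw [(hΓ k).proj_apply, q.2, ih fun m hm hmk => ha m hm (by omega)]

include hΓ in
theorem proj_eq_proj_of_ne_zero (ha : IsCutoff a) {k : ℕ} (hk : a (k + 1) ≠ 0) :
    (q.1 (k + 1)).proj = (Γ k (deformJet Γ a q k)).proj := by
  rw [q.2, (hΓ k).proj_apply, deformJet_eq_apply hπ hΓ fun m hm hmk => ha k m hm hmk hk]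

theorem topCoord_deform (ha : IsCutoff a) (c : BundleChart EX EY EF π) (k : ℕ) :
    ((deform hΓ a q).1 (k + 1)).topCoord c = a (k + 1) • (q.1 (k + 1)).topCoord c +
      (1 - a (k + 1)) • (Γ k ((deform hΓ a q).1 k)).topCoord c :=
  Jet.topCoord_combination hπ (proj_eq_proj_of_ne_zero hπ hΓ ha) c

theorem deform_one (ha : ∀ k, 1 ≤ k → a k = 1) : deform hΓ a q = q :=
  Subtype.ext (funext fun _ => deformJet_eq_apply hπ hΓ fun m hm _ => ha m hm)

theorem deform_zero (ha : ∀ k, 1 ≤ k → a k = 0) : deform hΓ a q = ofSections hπ hΓ q.eval := by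
  refine Subtype.ext (funext fun k => ?_)
  change deformJet Γ a q k = _
  induction k with
  | zero => exact (evalHomeomorph_symm_eval hπ q).symm
  | succ k ih =>
    rw [deformJet, ha (k + 1) (by omega), Jet.combination_zero hπ, ih]
    rfl

theorem deform_ofSections (a : ℕ → ℝ) (y : Y) :
    deform hΓ a (ofSections hπ hΓ y) = ofSections hπ hΓ y := by
  refine Subtype.ext (funext fun k => ?_)
  change deformJet Γ a _ k = _
  induction k with
  | zero => rfl
  | succ k ih =>
    rw [deformJet, ih]
    exact Jet.combination_self hπ _ _

theorem continuous_deform {Z : Type*} [TopologicalSpace Z] {a : ℕ → Z → ℝ}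
    {q : Z → JetInf EX EY EF π} (ha : ∀ k, 1 ≤ k → Continuous (a k))
    (hcutoff : ∀ z, IsCutoff fun k => a k z) (hq : Continuous q) :
    Continuous fun z => deform hΓ (fun k => a k z) (q z) := by
  refine Continuous.subtype_mk (continuous_pi fun k => ?_) _
  induction k with
  | zero => exact (continuous_apply 0).comp hq
  | succ k ih =>
    refine Jet.continuous_combination hπ (ha (k + 1) (by omega)) ((continuous_apply _).comp hq)
      ((hΓ k).continuous.comp ih) (fun z => ?_)
      fun z => proj_eq_proj_of_ne_zero hπ hΓ (hcutoff z)
    rw [eval_apply, Jet.eval_eq_of_proj_eq ((hΓ k).proj_apply _)]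
    exact (eval_apply (deform hΓ (fun k => a k z) (q z)) k).symm

theorem isStrongDeformationRetract_deform {f : ℕ → ℝ → ℝ} (hf : IsStepFamily f) :
    IsStrongDeformationRetract (ofSections hπ hΓ) eval
      fun w : I × JetInf EX EY EF π => deform hΓ (fun k => f k w.1) w.2 where
  isEmbedding := .of_leftInverse (eval_ofSections hπ hΓ) (continuous_eval hπ)
    (continuous_ofSections hπ hΓ)
  continuous_retraction := continuous_eval hπ
  retraction_apply := eval_ofSections hπ hΓ
  continuous_homotopy := continuous_deform hπ hΓ
    (fun k hk => (hf.continuousOn k hk).comp_continuous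
      (continuous_subtype_val.comp continuous_fst) fun w => w.1.2)
    (fun w => hf.isCutoff w.1.2) continuous_snd
  homotopy_zero _ := deform_zero hπ hΓ fun _ => hf.apply_zero
  homotopy_one _ := deform_one hπ hΓ fun _ => hf.apply_one
  homotopy_fixed _ y := deform_ofSections hπ hΓ _ y

end

end JetInf

end

theorem mainTheorem1_general
    {EX EY EF X Y : Type*}
    [NormedAddCommGroup EX] [NormedSpace ℝ EX]
    [NormedAddCommGroup EY] [NormedSpace ℝ EY] [FiniteDimensional ℝ EY]
    [NormedAddCommGroup EF] [NormedSpace ℝ EF]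
    [TopologicalSpace X] [ChartedSpace EX X]
    [TopologicalSpace Y] [ChartedSpace EY Y] [IsManifold 𝓘(ℝ, EY) ∞ Y]
    [T2Space Y] [SigmaCompactSpace Y]
    (π : Y → X) (hπ : IsFibredManifold EX EY EF π) :
    (∀ k, ∃ Γ : Jet EX EY EF π k → Jet EX EY EF π (k + 1), IsSmoothJetSection Γ) ∧
    (∃ f : ℕ → ℝ → ℝ, IsStepFamily f ∧ ∀ k, ContDiff ℝ ∞ (f k)) ∧
    ∀ Γ : (k : ℕ) → Jet EX EY EF π k → Jet EX EY EF π (k + 1),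
      (∀ k, IsContinuousJetSection (Γ k)) →
      ∃ γ : Y → JetInf EX EY EF π,
        (∀ y, (γ y).eval = y) ∧
        (∀ y k, (γ y).1 (k + 1) = Γ k ((γ y).1 k)) ∧
        ∀ f : ℕ → ℝ → ℝ, IsStepFamily f →
          ∃ H : I × JetInf EX EY EF π → JetInf EX EY EF π,
            IsStrongDeformationRetract γ JetInf.eval H ∧
            (∀ t q, (H (t, q)).eval = q.eval) ∧
            ∀ (c : BundleChart EX EY EF π) (t : I) (q : JetInf EX EY EF π),
              q.eval ∈ c.total.source → ∀ k : ℕ,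
                ((H (t, q)).1 (k + 1)).topCoord c =
                  f (k + 1) t • (q.1 (k + 1)).topCoord c +
                    (1 - f (k + 1) t) • (Γ k ((H (t, q)).1 k)).topCoord c := by
  refine ⟨Jet.exists_isSmoothJetSection hπ, exists_smooth_isStepFamily, fun Γ hΓ =>
    ⟨JetInf.ofSections hπ hΓ, JetInf.eval_ofSections hπ hΓ, fun _ _ => rfl, fun f hf =>
      ⟨fun w => JetInf.deform hΓ (fun k => f k w.1) w.2, ?_, fun _ _ => rfl, ?_⟩⟩⟩
  · exact JetInf.isStrongDeformationRetract_deform hπ hΓ hf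
  · exact fun c t q _ k => JetInf.topCoord_deform hπ hΓ (hf.isCutoff t.2) c k

theorem mainTheorem1
    {EX EY EF X Y F : Type*}
    [NormedAddCommGroup EX] [NormedSpace ℝ EX] [FiniteDimensional ℝ EX]
    [NormedAddCommGroup EY] [NormedSpace ℝ EY] [FiniteDimensional ℝ EY]
    [NormedAddCommGroup EF] [NormedSpace ℝ EF] [FiniteDimensional ℝ EF]
    [TopologicalSpace X] [ChartedSpace EX X] [IsManifold 𝓘(ℝ, EX) ∞ X]
    [T2Space X] [ParacompactSpace X] [ConnectedSpace X]
    [TopologicalSpace Y] [ChartedSpace EY Y] [IsManifold 𝓘(ℝ, EY) ∞ Y]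
    [T2Space Y] [ParacompactSpace Y] [ConnectedSpace Y]
    [TopologicalSpace F] [ChartedSpace EF F] [IsManifold 𝓘(ℝ, EF) ∞ F]
    (π : Y → X) (hπ : IsSmoothFibreBundle EX EY EF F π) :
    -- the affine jet bundles have smooth global sections
    (∀ k, ∃ Γ : Jet EX EY EF π k → Jet EX EY EF π (k + 1), IsSmoothJetSection Γ) ∧
    -- there are step functions, even smooth ones
    (∃ f : ℕ → ℝ → ℝ, IsStepFamily f ∧ ∀ k, ContDiff ℝ ∞ (f k)) ∧
    -- and any choice of sections and step functions gives a strong deformation retraction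
    ∀ Γ : (k : ℕ) → Jet EX EY EF π k → Jet EX EY EF π (k + 1),
      (∀ k, IsContinuousJetSection (Γ k)) →
      ∃ γ : Y → JetInf EX EY EF π,
        (∀ y, (γ y).eval = y) ∧
        (∀ y k, (γ y).1 (k + 1) = Γ k ((γ y).1 k)) ∧
        ∀ f : ℕ → ℝ → ℝ, IsStepFamily f →
          ∃ H : I × JetInf EX EY EF π → JetInf EX EY EF π,
            IsStrongDeformationRetract γ JetInf.eval H ∧
            (∀ t q, (H (t, q)).eval = q.eval) ∧
            ∀ (c : BundleChart EX EY EF π) (t : I) (q : JetInf EX EY EF π),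
              q.eval ∈ c.total.source → ∀ k : ℕ,
                ((H (t, q)).1 (k + 1)).topCoord c =
                  f (k + 1) t • (q.1 (k + 1)).topCoord c +
                    (1 - f (k + 1) t) • (Γ k ((H (t, q)).1 k)).topCoord c := by
  have : LocallyCompactSpace Y := ChartedSpace.locallyCompactSpace EY Y
  have : SigmaCompactSpace Y := sigmaCompactSpace_of_connectedSpace
  exact mainTheorem1_general π hπ.isFibredManifold
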